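/- **Setting.** Consider the linear system $x[k+1]=Ax[k]+Bu^*[k]$, $y[k]=Cx[k]+v[k]$ with $A\in\mathbb R^{n\times n}$, $B=[b_1,\dots,b_m]\in\mathbb R^{n\times m}$, $C\in\mathbb R^{p\times n}$, unknown initial state $x[0]=x_0^*$ and unknown inputs $u^*[k]\in\mathbb R^m$, observed at $k=0,\dots,N$. The coordinates of the noise vectors $v[0],\dots,v[N]\in\mathbb R^p$ are i.i.d. $\mathcal N(0,\sigma^2)$, $\sigma>0$. Put $T=p(N+1)$, let $y\in\mathbb R^{T}$ be the stacked measurements, $u_j^*=(u_j^*[0],\dots,u_j^*[N])$, $S=\{j:u_j^*\neq0\}$ and $m^*=|S|$, and assume $1\le m^*<m$. Let $H_0=0$ and $H_l=CA^{l-1}B$ for $l\ge1$. Let $O$ be the observability matrix with block rows $C,CA,\dots,CA^N$. Let $J_j\in\mathbb R^{T\times(N+1)}$ be the lower triangular block Toeplitz matrix whose block at times $(k,l)$, $l\le k$, is the $j$-th column of $H_{k-l}$. Let $J_S$ be the matrix of the columns of all $J_j$, $j\in S$, ordered by time and then by input, and put $\Psi_S=[O\ J_S]$. For $k\geq 0$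 let $O_k$ and $J_{S,[k:0]}$ be the same matrices for the horizon $\{0,\dots,k\}$, with $J_{S,[-1:0]}$ empty, of rank $0$. Let $\eta_S$ be the smallest $k\ge0$ with $\operatorname{rank}J_{S,[k:0]}-\operatorname{rank}J_{S,[k-1:0]}=m^*$, and $\mu_S$ the smallest $k\ge0$ with $\operatorname{rank}[O_k\ J_{S,[k:0]}]-\operatorname{rank}J_{S,[k:0]}=n$ ($\infty$ if there is none). Assume that $d:=\eta_S$ and $\mu_S$ are finite and $N\ge\max\{\eta_S,\mu_S\}$, and put $t_S=(N-d+1)m^*$. Let $\Psi_{S,[N:d]}$ consist of the columns of $\Psi_S$ of the initial state and of the inputs at times $0,\dots,N-d$, and $\Psi_{S,[d-1:0]}$ of the remaining columns. Below, $^+$ is the Moore–Penrose pseudoinverse and $\|\cdot\|_2$ the spectral norm of a matrix. **Assumptions.** For some constants $K$, $c_{\min}>0$ and $\alpha\in[0,1)$: * (A1) $\|O\|_2\le K\sqrt T$ and $\|J_j\|_2\le K\sqrt T$ for $j=1,\dots,m$; * (A2) $\big\|\big(\tfrac1T\Psi_{S,[N:d]}^{\mathsf T}M\Psi_{S,[N:d]}\big)^{+}\big\|_2\le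 1/c_{\min}$, where $M=I-\Psi_{S,[d-1:0]}\Psi_{S,[d-1:0]}^{+}$; * (A3) $\max_{j\notin S}\|J_j^{\mathsf T}\Psi_S(\Psi_S^{\mathsf T}\Psi_S)^{+}\|_2\le\alpha/m^*$. For $\delta>0$ put $$\lambda_T=\frac{\sqrt{32}\,K\sigma}{1-\alpha}\left\{\sqrt{\frac{(N+1)\log5+\log(m-m^*)}{T}}+\frac\delta2\right\},$$ $$\beta_{\min}=\frac{\sigma}{\sqrt{c_{\min}}}\left\{\sqrt{\frac{2\log t_S}{T}}+\delta\right\}+\lambda_T\left\|\Pi\left(\frac{\Psi_S^{\mathsf T}\Psi_S}{T}\right)^{+}\right\|_\infty,$$ where $\Pi=[0_{t_S\times n}\ I_{t_S}\ 0_{t_S\times dm^*}]$ selects the inputs at times $0,\dots,N-d$ and $\|\cdot\|_\infty$ is the largest absolute row sum. Assume that $\min_{j\in S}\max_{0\le k\le N-d}|u_j^*[k]|\ge\beta_{\min}$. **Estimators.** A group LASSO estimate is any minimizer $(\widehat x_0,\widehat u_1,\dots,\widehat u_m)$ over $\mathbb R^n\times(\mathbb R^{N+1})^m$ of $\frac1{2T}\|y-Ox_0-\sum_jJ_ju_j\|_2^2+\lambda_T\sum_j\|u_j\|_2$;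 put $\widehat S=\{j:\widehat u_j\ne0\}$. The refit least-squares estimate $\widehat\beta^{(OLS)}_{\widehat S,[0:N-d]}$ consists of the coordinates of $\Psi_{\widehat S}^{+}y$ for the initial state and the inputs at times $0,\dots,N-d$. Let $\beta^*_{S,[0:N-d]}=(x_0^*,u^*_S[0],\dots,u^*_S[N-d])$. **Theorem.** For all $\delta,\delta_1>0$ (the same $\delta$ as in $\lambda_T$ and $\beta_{\min}$), with probability at least $1-4\exp(-T\delta^2/2)-\delta_1$, a group LASSO estimate exists and every group LASSO estimate satisfies $\widehat S=S$ and $$\big\|\beta^*_{S,[0:N-d]}-\widehat\beta^{(OLS)}_{\widehat S,[0:N-d]}\big\|_2\le\frac{4\sigma}{\sqrt{c_{\min}}}\sqrt{\frac{n+t_S}{T}}+\frac{2\sigma}{\sqrt{c_{\min}}}\sqrt{\frac1T\log\frac1{\delta_1}}.$$ (For $\delta_1\ge1$ there is nothing to prove, since the probability bound is then negative.) -/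

import Mathlib

open Matrix MeasureTheory ProbabilityTheory

namespace GroupLasso

/-! ### Norms of vectors and matrices -/

/-- The Euclidean norm `‖f‖₂` of a real vector. -/
noncomputable def l2norm {ι : Type*} [Fintype ι] (f : ι → ℝ) : ℝ :=
  ‖(WithLp.toLp 2 f : EuclideanSpace ℝ ι)‖

open scoped Matrix.Norms.L2Operator in
/-- The spectral norm `‖M‖₂` of a real matrix (operator norm between Euclidean spaces). -/
noncomputable def specNorm {r c : Type*} [Fintype r] [Fintype c] [DecidableEq c]
    (M : Matrix r c ℝ) : ℝ := ‖M‖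

/-- The norm `‖M‖_∞` of a real matrix: the operator norm between sup-normed spaces, that is the
largest absolute row sum. -/
noncomputable def rowSumNorm {r c : Type*} [Fintype c] (M : Matrix r c ℝ) : ℝ :=
  ⨆ i, ∑ j, |M i j|

/-! ### The Moore-Penrose pseudoinverse -/

/-- `X` satisfies the four Penrose equations for the real matrix `A`. -/
structure IsMoorePenrose {r c : Type*} [Fintype r] [Fintype c]
    (A : Matrix r c ℝ) (X : Matrix c r ℝ) : Prop where
  mul_mul_self : A * X * A = A
  mul_mul_inv : X * A * X = X
  symm_left : (A * X)ᵀ = A * X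
  symm_right : (X * A)ᵀ = X * A

theorem IsMoorePenrose.unique {r c : Type*} [Fintype r] [Fintype c]
    {A : Matrix r c ℝ} {X Y : Matrix c r ℝ} (hX : IsMoorePenrose A X) (hY : IsMoorePenrose A Y) :
    X = Y := by
  have h1 : A * Y * (A * X) = A * Y := by
    rw [← hY.symm_left, ← hX.symm_left, ← transpose_mul, ← Matrix.mul_assoc, hX.mul_mul_self]
  have h2 : Y * A * (X * A) = X * A := by
    rw [← hY.symm_right, ← hX.symm_right, ← transpose_mul, Matrix.mul_assoc X A (Y * A),
      ← Matrix.mul_assoc A Y A, hY.mul_mul_self]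
  have e1 : X = X * A * Y := by
    calc X = X * (A * X) := by rw [← Matrix.mul_assoc, hX.mul_mul_inv]
      _ = X * (A * Y * A * X) := by rw [hY.mul_mul_self]
      _ = X * (A * Y * (A * X)) := by simp only [Matrix.mul_assoc]
      _ = X * A * Y := by rw [h1, ← Matrix.mul_assoc]
  have e2 : Y = X * A * Y := by
    calc Y = Y * A * Y := hY.mul_mul_inv.symm
      _ = Y * (A * X * A) * Y := by rw [hX.mul_mul_self]
      _ = Y * A * (X * A) * Y := by simp only [Matrix.mul_assoc]
      _ = X * A * Y := by rw [h2]
  rw [e1, ← e2]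

theorem exists_isMoorePenrose {r c : Type*} [Fintype r] [Fintype c] (A : Matrix r c ℝ) :
    ∃ X : Matrix c r ℝ, IsMoorePenrose A X := by
  classical
  have hA : (Aᵀ * A).IsHermitian := by
    simpa using Matrix.isHermitian_conjTranspose_mul_self A
  -- a symmetric generalized inverse of the Gram matrix, from the spectral theorem
  obtain ⟨G, hGs, hHG, hGH, hcomm⟩ : ∃ G : Matrix c c ℝ, Gᵀ = G ∧
      (Aᵀ * A) * G * (Aᵀ * A) = Aᵀ * A ∧ G * (Aᵀ * A) * G = G ∧
      (G * (Aᵀ * A))ᵀ = G * (Aᵀ * A) := by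
    obtain ⟨U, e, hUU, hH⟩ : ∃ (U : Matrix c c ℝ) (e : c → ℝ), Uᵀ * U = 1 ∧
        Aᵀ * A = U * diagonal e * Uᵀ := by
      refine ⟨(hA.eigenvectorUnitary : Matrix c c ℝ), hA.eigenvalues, ?_, ?_⟩
      · have := Unitary.star_mul_self_of_mem hA.eigenvectorUnitary.2
        simpa [Matrix.star_eq_conjTranspose] using this
      · have := hA.spectral_theorem
        rw [Unitary.conjStarAlgAut_apply] at this
        simpa [Matrix.star_eq_conjTranspose, Function.comp_def] using this
    have key : ∀ a b : c → ℝ, U * diagonal a * Uᵀ * (U * diagonal b * Uᵀ)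
        = U * diagonal (fun i => a i * b i) * Uᵀ := by
      intro a b
      calc U * diagonal a * Uᵀ * (U * diagonal b * Uᵀ)
          = U * diagonal a * (Uᵀ * U) * diagonal b * Uᵀ := by simp only [Matrix.mul_assoc]
        _ = _ := by rw [hUU, Matrix.mul_one, Matrix.mul_assoc U, diagonal_mul_diagonal]
    have sym : ∀ a : c → ℝ, (U * diagonal a * Uᵀ)ᵀ = U * diagonal a * Uᵀ := by
      intro a
      simp [transpose_mul, Matrix.mul_assoc]
    refine ⟨U * diagonal (fun i => (e i)⁻¹) * Uᵀ, sym _, ?_, ?_, ?_⟩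
    · rw [hH, key, key]
      congr 3
      funext i
      by_cases h : e i = 0
      · simp [h]
      · field_simp
    · rw [hH, key, key]
      congr 3
      funext i
      by_cases h : e i = 0
      · simp [h]
      · field_simp
    · rw [hH, key, sym]
  have hAG : A * (G * (Aᵀ * A)) = A := by
    have h0 : Aᵀ * A * (G * (Aᵀ * A) - 1) = 0 := by
      rw [Matrix.mul_sub, ← Matrix.mul_assoc, hHG, Matrix.mul_one, sub_self]
    have h1 := (Matrix.conjTranspose_mul_self_mul_eq_zero A (G * (Aᵀ * A) - 1)).1
      (by simpa using h0)
    rw [Matrix.mul_sub, Matrix.mul_one] at h1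
    exact sub_eq_zero.1 h1
  refine ⟨G * Aᵀ, ?_, ?_, ?_, ?_⟩
  · simpa only [Matrix.mul_assoc] using hAG
  · calc G * Aᵀ * A * (G * Aᵀ) = G * (Aᵀ * A) * G * Aᵀ := by simp only [Matrix.mul_assoc]
      _ = G * Aᵀ := by rw [hGH]
  · simp [transpose_mul, hGs, Matrix.mul_assoc]
  · rw [Matrix.mul_assoc]
    exact hcomm

/-- The Moore-Penrose pseudoinverse `A⁺`: the unique solution of the Penrose equations. -/
noncomputable def pinv {r c : Type*} [Fintype r] [Fintype c] (A : Matrix r c ℝ) : Matrix c r ℝ :=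
  (exists_isMoorePenrose A).choose

theorem pinv_spec {r c : Type*} [Fintype r] [Fintype c] (A : Matrix r c ℝ) :
    IsMoorePenrose A (pinv A) :=
  (exists_isMoorePenrose A).choose_spec

/-! ### The linear system and its batch matrices -/

/-- The matrices of a discrete-time linear system with `n` states, `m` scalar inputs and `p`
sensors: `x[k+1] = A x[k] + B u[k]`, `y[k] = C x[k] + v[k]`. -/
structure LinSys (n m p : ℕ) where
  A : Matrix (Fin n) (Fin n) ℝ
  B : Matrix (Fin n) (Fin m) ℝ
  C : Matrix (Fin p) (Fin n) ℝ

variable {n m p : ℕ}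

/-- The state trajectory from the initial state `x0` under the input signal `u`. -/
def LinSys.state (sys : LinSys n m p) (x0 : Fin n → ℝ) (u : ℕ → Fin m → ℝ) : ℕ → Fin n → ℝ
  | 0 => x0
  | k + 1 => sys.A *ᵥ sys.state x0 u k + sys.B *ᵥ u k

/-- The batch of noisy measurements `y[k] = C x[k] + v[k]`, `k = 0, …, L - 1`. -/
def LinSys.measurement (sys : LinSys n m p) (L : ℕ) (x0 : Fin n → ℝ) (u : ℕ → Fin m → ℝ)
    (v : Fin L × Fin p → ℝ) : Fin L × Fin p → ℝ :=
  fun ki => (sys.C *ᵥ sys.state x0 u ki.1) ki.2 + v ki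

/-- The Markov parameters of all inputs: `H 0 = 0` and `H l = C A^(l-1) B`; column `j` belongs to
input `j`. -/
def LinSys.markov (sys : LinSys n m p) : ℕ → Matrix (Fin p) (Fin m) ℝ
  | 0 => 0
  | l + 1 => sys.C * sys.A ^ l * sys.B

/-- The observability matrix with `L` block rows `C, C A, …, C A^(L-1)`. -/
def LinSys.obs (sys : LinSys n m p) (L : ℕ) : Matrix (Fin L × Fin p) (Fin n) ℝ :=
  Matrix.of fun ki s => (sys.C * sys.A ^ (ki.1 : ℕ)) ki.2 s

/-- The forced impulse response matrix of input `j` with `L` block rows: the lower triangular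
block Toeplitz matrix of the Markov parameters of input `j`. -/
def LinSys.impulse (sys : LinSys n m p) (L : ℕ) (j : Fin m) :
    Matrix (Fin L × Fin p) (Fin L) ℝ :=
  Matrix.of fun ki l => if l ≤ ki.1 then sys.markov ((ki.1 : ℕ) - (l : ℕ)) ki.2 j else 0

/-- The joint impulse response matrix of the inputs in `S`, with `L` block rows. Columns are
indexed by (time, input). With `L = k + 1` this is the matrix written `J_{S,[k:0]}`. -/
def LinSys.impulseSet (sys : LinSys n m p) (L : ℕ) (S : Finset (Fin m)) :
    Matrix (Fin L × Fin p) (Fin L × S) ℝ :=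
  Matrix.of fun ki lj => sys.impulse L lj.2 ki lj.1

/-- `Ψ_S = [O J_S]` with `L` block rows. -/
def LinSys.Psi (sys : LinSys n m p) (L : ℕ) (S : Finset (Fin m)) :
    Matrix (Fin L × Fin p) (Fin n ⊕ (Fin L × S)) ℝ :=
  Matrix.fromCols (sys.obs L) (sys.impulseSet L S)

/-! ### Delays -/

/-- The delay `η_S`: the smallest `k` with `rank J_{S,[k:0]} - rank J_{S,[k-1:0]} = |S|`
(the second matrix being empty for `k = 0`); it is `⊤` if there is none. -/
noncomputable def LinSys.inputDelay (sys : LinSys n m p) (S : Finset (Fin m)) : ℕ∞ :=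
  ⨅ k ∈ {k : ℕ | (sys.impulseSet (k + 1) S).rank = (sys.impulseSet k S).rank + S.card}, (k : ℕ∞)

/-- The delay `μ_S`: the smallest `k` with `rank [O_k J_{S,[k:0]}] - rank J_{S,[k:0]} = n`;
it is `⊤` if there is none. -/
noncomputable def LinSys.stateDelay (sys : LinSys n m p) (S : Finset (Fin m)) : ℕ∞ :=
  ⨅ k ∈ {k : ℕ | (sys.Psi (k + 1) S).rank = (sys.impulseSet (k + 1) S).rank + n}, (k : ℕ∞)

/-! ### The delayed part of the unknowns, on the horizon `{0, …, N}` -/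

/-- The times `0, …, N - d`. -/
abbrev EarlyTime (N d : ℕ) : Type := {k : Fin (N + 1) // (k : ℕ) + d ≤ N}

/-- The times `N - d + 1, …, N`. -/
abbrev LateTime (N d : ℕ) : Type := {k : Fin (N + 1) // N < (k : ℕ) + d}

/-- `Ψ_{S,[N:d]}`: the columns of `Ψ_S` of the initial state and of the inputs at the times
`0, …, N - d`. -/
def LinSys.PsiEarly (sys : LinSys n m p) (N d : ℕ) (S : Finset (Fin m)) :
    Matrix (Fin (N + 1) × Fin p) (Fin n ⊕ (EarlyTime N d × S)) ℝ :=
  (sys.Psi (N + 1) S).submatrix id (Sum.map id (Prod.map Subtype.val id))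

/-- `Ψ_{S,[d-1:0]}`: the columns of `Ψ_S` of the inputs at the times `N - d + 1, …, N`. -/
def LinSys.PsiLate (sys : LinSys n m p) (N d : ℕ) (S : Finset (Fin m)) :
    Matrix (Fin (N + 1) × Fin p) (LateTime N d × S) ℝ :=
  (sys.Psi (N + 1) S).submatrix id (fun lj => Sum.inr (lj.1.val, lj.2))

/-- The orthogonal projection `M = I - Ψ_{S,[d-1:0]} Ψ_{S,[d-1:0]}⁺`. -/
noncomputable def LinSys.lateProj (sys : LinSys n m p) (N d : ℕ) (S : Finset (Fin m)) :
    Matrix (Fin (N + 1) × Fin p) (Fin (N + 1) × Fin p) ℝ :=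
  1 - sys.PsiLate N d S * pinv (sys.PsiLate N d S)

/-- The set of inputs that are nonzero at some time of the horizon `{0, …, N}`. -/
noncomputable def activeSet (N : ℕ) (u : ℕ → Fin m → ℝ) : Finset (Fin m) := by
  classical exact Finset.univ.filter fun j => ∃ k ≤ N, u k j ≠ 0

/-- The dimension `T = p (N + 1)` of the batch of measurements. -/
def numMeas (N p : ℕ) : ℝ := (p : ℝ) * ((N : ℝ) + 1)

/-! ### Assumptions -/

/-- Group normalization with constant `K`. -/
def LinSys.GroupNormalized (sys : LinSys n m p) (N : ℕ) (K : ℝ) : Prop :=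
  specNorm (sys.obs (N + 1)) ≤ K * √(numMeas N p) ∧
    ∀ j, specNorm (sys.impulse (N + 1) j) ≤ K * √(numMeas N p)

/-- The least singular value condition with constant `cmin`. -/
def LinSys.LeastSingularValue (sys : LinSys n m p) (N d : ℕ) (S : Finset (Fin m)) (cmin : ℝ) :
    Prop :=
  specNorm (pinv ((numMeas N p)⁻¹ •
    ((sys.PsiEarly N d S)ᵀ * sys.lateProj N d S * sys.PsiEarly N d S))) ≤ 1 / cmin

/-- The mutual incoherence condition with parameter `α`. -/
def LinSys.MutualIncoherence (sys : LinSys n m p) (N : ℕ) (S : Finset (Fin m)) (α : ℝ) : Prop :=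
  ∀ j ∉ S, specNorm ((sys.impulse (N + 1) j)ᵀ * sys.Psi (N + 1) S *
    pinv ((sys.Psi (N + 1) S)ᵀ * sys.Psi (N + 1) S)) ≤ α / S.card

/-! ### Estimators -/

/-- The group LASSO objective
`‖y - O x - ∑ j, J_j u_j‖₂² / (2 T) + lam * ∑ j, ‖u_j‖₂`; `u j` is the batch of input `j`. -/
noncomputable def LinSys.lassoObjective (sys : LinSys n m p) (N : ℕ) (lam : ℝ)
    (y : Fin (N + 1) × Fin p → ℝ) (x : Fin n → ℝ) (u : Fin m → Fin (N + 1) → ℝ) : ℝ :=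
  1 / (2 * numMeas N p) *
      l2norm (y - sys.obs (N + 1) *ᵥ x - ∑ j, sys.impulse (N + 1) j *ᵥ u j) ^ 2
    + lam * ∑ j, l2norm (u j)

/-- `(x, u)` is a group LASSO estimate: a global minimizer of the group LASSO objective. -/
def LinSys.IsGroupLasso (sys : LinSys n m p) (N : ℕ) (lam : ℝ)
    (y : Fin (N + 1) × Fin p → ℝ) (x : Fin n → ℝ) (u : Fin m → Fin (N + 1) → ℝ) : Prop :=
  ∀ x' u', sys.lassoObjective N lam y x u ≤ sys.lassoObjective N lam y x' u'

/-- The support `{j : û_j ≠ 0}` of an estimate. -/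
noncomputable def supportSet {N : ℕ} (u : Fin m → Fin (N + 1) → ℝ) : Finset (Fin m) := by
  classical exact Finset.univ.filter fun j => u j ≠ 0

open Classical in
/-- The least-squares estimate `Ψ_R⁺ y` refit on a set `R` of inputs, restricted to the initial
state and the inputs at the times `0, …, N - d`. For every `R` it is recorded as a vector that
carries the coordinates of all `m` inputs, those of inputs outside `R` being zero, so that it can
be compared with the true vector whatever `R` is. -/
noncomputable def LinSys.delayedOLS (sys : LinSys n m p) (N d : ℕ) (R : Finset (Fin m))
    (y : Fin (N + 1) × Fin p → ℝ) : Fin n ⊕ (EarlyTime N d × Fin m) → ℝ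
  | Sum.inl s => (pinv (sys.Psi (N + 1) R) *ᵥ y) (Sum.inl s)
  | Sum.inr (k, j) =>
      if h : j ∈ R then (pinv (sys.Psi (N + 1) R) *ᵥ y) (Sum.inr (k.val, ⟨j, h⟩)) else 0

/-- The true initial state and inputs at the times `0, …, N - d`, with the coordinates of all `m`
inputs (those outside the active set are zero). -/
def delayedTruth (N d : ℕ) (x0 : Fin n → ℝ) (u : ℕ → Fin m → ℝ) :
    Fin n ⊕ (EarlyTime N d × Fin m) → ℝ
  | Sum.inl s => x0 s
  | Sum.inr (k, j) => u k.val j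

/-! ### Constants -/

/-- The number `t_S = (N - d + 1) |S|` of delayed inputs (a real number; used for `d ≤ N`). -/
def numDelayed (N d : ℕ) (S : Finset (Fin m)) : ℝ := ((N : ℝ) - d + 1) * S.card

/-- The regularization parameter `λ_T`. -/
noncomputable def lambdaT (N m p : ℕ) (S : Finset (Fin m)) (σ K α δ : ℝ) : ℝ :=
  √32 * K * σ / (1 - α) *
    (√((((N : ℝ) + 1) * Real.log 5 + Real.log ((m : ℝ) - S.card)) / numMeas N p) + δ / 2)

/-- The rows of `(Ψ_Sᵀ Ψ_S / T)⁺` of the inputs at the times `0, …, N - d`. -/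
noncomputable def LinSys.delayedGramPinv (sys : LinSys n m p) (N d : ℕ) (S : Finset (Fin m)) :
    Matrix (EarlyTime N d × S) (Fin n ⊕ (Fin (N + 1) × S)) ℝ :=
  (pinv ((numMeas N p)⁻¹ • ((sys.Psi (N + 1) S)ᵀ * sys.Psi (N + 1) S))).submatrix
    (fun kj => Sum.inr (kj.1.val, kj.2)) id

/-- The detection threshold `β_min`. -/
noncomputable def LinSys.betaMin (sys : LinSys n m p) (N d : ℕ) (S : Finset (Fin m))
    (σ K α δ cmin : ℝ) : ℝ :=
  σ / √cmin * (√(2 * Real.log (numDelayed N d S) / numMeas N p) + δ)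
    + lambdaT N m p S σ K α δ * rowSumNorm (sys.delayedGramPinv N d S)

end GroupLasso

/-!
Write `Ψ = Ψ_S`, `y = Ψ β* + v`, and let `M` be the projection off the late columns of `Ψ`.

*Identifiability.* The finite delays make the early coordinates (initial state and inputs up to time
`N - d`) of any `z` a function of `Ψ z`, although `Ψ` itself has a kernel. A rank increment of
`|S|` says that delaying a batch by one step maps the kernel for one horizon onto the kernel for
the next, so that the first input of a kernel element vanishes
(`LinSys.input_zero_of_forced_eq_zero`); the Toeplitz structure propagates this in time
(`LinSys.comp_earlyIndex_eq_zero`). By Frisch-Waugh-Lovell the early rows of `Ψ⁺` are then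
`R = G⁻¹ Ψ_eᵀ M` with `G = Ψ_eᵀ M Ψ_e`, and `R Rᵀ = G⁻¹` has norm at most `1 / (T cmin)`
(`pinv_mulVec_comp_eq`, `l2norm_partialOut_transpose_mulVec_sq`).

*Support recovery* is a primal-dual witness argument for a fixed noise vector. A minimizer among the
points supported in `S` exists because the unpenalized observability matrix is injective
(`exists_isRestrictedMin`). Its residual `ρ` splits into the projected noise `(I - Ψ Ψ⁺) v` and the
shrinkage part `Ψ (Ψᵀ Ψ)⁺ Ψᵀ ρ`; mutual incoherence bounds the correlation of the latter with the
inactive inputs by `α T λ`. If the noise part stays below `(1 - α) T λ`, the dual certificate is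
strictly feasible, so all global minimizers are supported in `S` (`IsRestrictedMin.global`). Each of
them satisfies `(Ψᵀ Ψ)⁺ Ψᵀ ρ = Ψ⁺ ρ`, which bounds its error in the early inputs by the noise `R v`
plus `λ ‖Π (Ψᵀ Ψ / T)⁺‖_∞` (`LinSys.abs_delayed_error_le`); the threshold `β_min` exceeds this, so
no active input is lost (`LinSys.support_recovery`). Once the support is right, the error of the
refit estimate is exactly `R v`.

*Probability.* Three noise events have to be excluded: large `J_jᵀ (I - Ψ Ψ⁺) v` for an inactive
`j`, a large coordinate of `R v`, and a large norm of `R v`. All these vectors are sub-Gaussian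
(`IsSubgaussianVector`). Norms are controlled by
`E exp (‖X‖² / (4 τ²)) ≤ √2 ^ dim`, proved by decoupling with an independent Gaussian vector
(`IsSubgaussianVector.lintegral_exp_l2norm_sq_le`), and coordinates by the scalar Chernoff bound; a
union bound concludes.
-/

namespace GroupLasso

/-! ### Euclidean and spectral norms -/

theorem l2norm_sq {ι : Type*} [Fintype ι] (f : ι → ℝ) : l2norm f ^ 2 = f ⬝ᵥ f := by
  rw [l2norm, EuclideanSpace.norm_sq_eq]
  simp [dotProduct, sq]

theorem l2norm_nonneg {ι : Type*} [Fintype ι] (f : ι → ℝ) : 0 ≤ l2norm f := norm_nonneg _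

theorem l2norm_add_le {ι : Type*} [Fintype ι] (f g : ι → ℝ) :
    l2norm (f + g) ≤ l2norm f + l2norm g := norm_add_le _ _

theorem l2norm_smul {ι : Type*} [Fintype ι] (a : ℝ) (f : ι → ℝ) :
    l2norm (a • f) = |a| * l2norm f := norm_smul a _

@[simp] theorem l2norm_zero {ι : Type*} [Fintype ι] : l2norm (0 : ι → ℝ) = 0 := norm_zero

theorem l2norm_neg {ι : Type*} [Fintype ι] (f : ι → ℝ) : l2norm (-f) = l2norm f := norm_neg _

theorem l2norm_eq_zero {ι : Type*} [Fintype ι] {f : ι → ℝ} : l2norm f = 0 ↔ f = 0 := by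
  rw [← sq_eq_zero_iff, l2norm_sq, dotProduct_self_eq_zero]

theorem l2norm_pos {ι : Type*} [Fintype ι] {f : ι → ℝ} (hf : f ≠ 0) : 0 < l2norm f :=
  lt_of_le_of_ne (l2norm_nonneg f) fun h => hf (l2norm_eq_zero.1 h.symm)

theorem continuous_l2norm {ι : Type*} [Fintype ι] :
    Continuous (l2norm : (ι → ℝ) → ℝ) := by
  unfold l2norm
  fun_prop

theorem dotProduct_le_l2norm {ι : Type*} [Fintype ι] (f g : ι → ℝ) :
    f ⬝ᵥ g ≤ l2norm f * l2norm g := by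
  have := real_inner_le_norm (WithLp.toLp 2 f : EuclideanSpace ℝ ι) (WithLp.toLp 2 g)
  simpa [l2norm, EuclideanSpace.inner_eq_star_dotProduct, dotProduct_comm] using this

theorem abs_apply_le_l2norm {ι : Type*} [Fintype ι] (f : ι → ℝ) (i : ι) :
    |f i| ≤ l2norm f := by
  simpa [l2norm] using PiLp.norm_apply_le (WithLp.toLp 2 f : EuclideanSpace ℝ ι) i

theorem norm_le_l2norm {ι : Type*} [Fintype ι] (f : ι → ℝ) : ‖f‖ ≤ l2norm f :=
  (pi_norm_le_iff_of_nonneg (l2norm_nonneg f)).2 fun i => abs_apply_le_l2norm f i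

open scoped Matrix.Norms.L2Operator in
theorem l2norm_mulVec_le {r c : Type*} [Fintype r] [Fintype c] [DecidableEq c]
    (M : Matrix r c ℝ) (x : c → ℝ) : l2norm (M *ᵥ x) ≤ specNorm M * l2norm x :=
  Matrix.l2_opNorm_mulVec M (WithLp.toLp 2 x)

open scoped Matrix.Norms.L2Operator in
theorem specNorm_nonneg {r c : Type*} [Fintype r] [Fintype c] [DecidableEq c]
    (M : Matrix r c ℝ) : 0 ≤ specNorm M :=
  norm_nonneg M

/-- Duality: a bound on the linear functional `⟨g, ·⟩` over the unit ball bounds `‖g‖₂`. -/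
theorem l2norm_le_of_forall_dotProduct_le {ι : Type*} [Fintype ι] {g : ι → ℝ} {c : ℝ}
    (hc : 0 ≤ c) (h : ∀ w, g ⬝ᵥ w ≤ c * l2norm w) : l2norm g ≤ c := by
  rcases eq_or_ne g 0 with rfl | hg
  · simpa using hc
  · have := h g
    rw [← l2norm_sq, sq] at this
    exact le_of_mul_le_mul_right this (l2norm_pos hg)

/-! ### Pseudoinverses -/

section pinv

variable {r c : Type*} [Fintype r] [Fintype c] (A : Matrix r c ℝ)

theorem pinv_smul {t : ℝ} (ht : t ≠ 0) : pinv (t • A) = t⁻¹ • pinv A := by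
  obtain ⟨h1, h2, h3, h4⟩ := pinv_spec A
  refine (pinv_spec (t • A)).unique ⟨?_, ?_, ?_, ?_⟩ <;>
    simp [smul_smul, ht, h1, h2, h3, h4]

/-- With `X = A⁺`, the pseudoinverse of the Gram matrix `Aᵀ A` is `X Xᵀ`. -/
theorem pinv_gram : pinv (Aᵀ * A) = pinv A * (pinv A)ᵀ := by
  obtain ⟨h1, h2, h3, h4⟩ := pinv_spec A
  set X := pinv A
  have e1 : Aᵀ * A * (X * Xᵀ) = X * A := by
    calc Aᵀ * A * (X * Xᵀ) = Aᵀ * (A * X) * Xᵀ := by simp only [Matrix.mul_assoc]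
      _ = Aᵀ * (A * X)ᵀ * Xᵀ := by rw [h3]
      _ = (X * (A * X) * A)ᵀ := by simp only [transpose_mul, Matrix.mul_assoc]
      _ = X * A := by rw [← Matrix.mul_assoc, h2, h4]
  have e2 : X * Xᵀ * (Aᵀ * A) = X * A := by
    calc X * Xᵀ * (Aᵀ * A) = X * (A * X)ᵀ * A := by
          simp only [transpose_mul, Matrix.mul_assoc]
      _ = X * A := by rw [h3, ← Matrix.mul_assoc, h2]
  refine (pinv_spec _).unique ⟨?_, ?_, ?_, ?_⟩
  · calc Aᵀ * A * (X * Xᵀ) * (Aᵀ * A) = (X * A)ᵀ * (Aᵀ * A) := by rw [e1, h4]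
      _ = (A * X * A)ᵀ * A := by simp only [transpose_mul, Matrix.mul_assoc]
      _ = Aᵀ * A := by rw [h1]
  · rw [e2, ← Matrix.mul_assoc, h2]
  · rw [e1, h4]
  · rw [e2, h4]

theorem pinv_eq_pinv_gram_mul : pinv A = pinv (Aᵀ * A) * Aᵀ := by
  obtain ⟨h1, h2, h3, h4⟩ := pinv_spec A
  rw [pinv_gram, Matrix.mul_assoc, ← transpose_mul, h3, ← Matrix.mul_assoc, h2]

/-- The residual `y - A A⁺ y` is orthogonal to the columns of `A`. -/
theorem transpose_mul_one_sub_pinv [DecidableEq r] : Aᵀ * (1 - A * pinv A) = 0 := by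
  obtain ⟨h1, h2, h3, h4⟩ := pinv_spec A
  rw [Matrix.mul_sub, Matrix.mul_one, ← h3, ← transpose_mul, h1, sub_self]

theorem one_sub_pinv_transpose [DecidableEq r] : (1 - A * pinv A)ᵀ = 1 - A * pinv A := by
  rw [transpose_sub, transpose_one, (pinv_spec A).symm_left]

theorem one_sub_pinv_mul [DecidableEq r] : (1 - A * pinv A) * A = 0 := by
  rw [Matrix.sub_mul, Matrix.one_mul, (pinv_spec A).mul_mul_self, sub_self]

theorem one_sub_pinv_idem [DecidableEq r] :
    (1 - A * pinv A) * (1 - A * pinv A) = 1 - A * pinv A := by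
  rw [Matrix.mul_sub, ← Matrix.mul_assoc, one_sub_pinv_mul, Matrix.zero_mul, sub_zero,
    Matrix.mul_one]

theorem l2norm_one_sub_pinv_mulVec_le [DecidableEq r] (w : r → ℝ) :
    l2norm ((1 - A * pinv A) *ᵥ w) ≤ l2norm w := by
  rcases eq_or_ne ((1 - A * pinv A) *ᵥ w) 0 with h | h
  · rw [h, l2norm_zero]; exact l2norm_nonneg w
  · refine le_of_mul_le_mul_left ?_ (l2norm_pos h)
    refine le_trans (le_of_eq ?_) (dotProduct_le_l2norm ((1 - A * pinv A) *ᵥ w) w)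
    rw [← sq, l2norm_sq]
    conv_lhs => rw [dotProduct_mulVec, ← mulVec_transpose, mulVec_mulVec,
      one_sub_pinv_transpose, one_sub_pinv_idem]

theorem pinv_mul_self_of_injective [DecidableEq c] (h : ∀ z, A *ᵥ z = 0 → z = 0) :
    pinv A * A = 1 := by
  refine Matrix.ext_of_mulVec_single fun i => ?_
  rw [one_mulVec, ← sub_eq_zero]
  apply h
  rw [mulVec_sub, mulVec_mulVec, ← Matrix.mul_assoc, (pinv_spec A).mul_mul_self, sub_self]

end pinv

/-! ### Kernels and ranks -/

/-- If `E` embeds the kernel of `B` into the kernel of `A` and the two kernels have the same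
dimension, then the kernel of `A` lies in the range of `E`. -/
theorem exists_eq_of_mulVec_eq_zero {r c r' c' : Type*} [Fintype r] [Fintype c] [Fintype r']
    [Fintype c'] (A : Matrix r c ℝ) (B : Matrix r' c' ℝ)
    (E : (c' → ℝ) →ₗ[ℝ] (c → ℝ)) (hE : Function.Injective E)
    (hker : ∀ w, B *ᵥ w = 0 → A *ᵥ E w = 0)
    (hrank : A.rank + Fintype.card c' = B.rank + Fintype.card c)
    {z : c → ℝ} (hz : A *ᵥ z = 0) : ∃ w, E w = z := by
  have h1 := LinearMap.finrank_range_add_finrank_ker A.mulVecLin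
  have h2 := LinearMap.finrank_range_add_finrank_ker B.mulVecLin
  rw [Module.finrank_fintype_fun_eq_card] at h1 h2
  have h3 : (LinearMap.ker B.mulVecLin).map E = LinearMap.ker A.mulVecLin := by
    apply Submodule.eq_of_le_of_finrank_eq
    · rintro _ ⟨w, hw, rfl⟩
      exact hker w hw
    · rw [LinearEquiv.finrank_eq (Submodule.equivMapOfInjective E hE _).symm]
      unfold Matrix.rank at hrank
      omega
  have h4 : z ∈ (LinearMap.ker B.mulVecLin).map E := by
    rw [h3]; exact hz
  obtain ⟨w, -, hw⟩ := h4
  exact ⟨w, hw⟩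

/-! ### Partialling out a block of columns -/

section partialOut

variable {r c e l : Type*} [Fintype c] [Fintype e] [Fintype l]
  {Ψ : Matrix r c ℝ} {fe : e → c} {fl : l → c}

theorem mulVec_eq_add_of_bijective (hf : Function.Bijective (Sum.elim fe fl)) (z : c → ℝ) :
    Ψ *ᵥ z = Ψ.submatrix id fe *ᵥ (z ∘ fe) + Ψ.submatrix id fl *ᵥ (z ∘ fl) := by
  ext i
  simp only [mulVec, dotProduct, Pi.add_apply, submatrix_apply, id, Function.comp]
  rw [← hf.sum_comp fun k => Ψ i k * z k, Fintype.sum_sum_type]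
  rfl

variable [Fintype r]

/-- `M = I - Ψ_l Ψ_l⁺` does not kill a combination of the columns `fe` of `Ψ` if their
coefficients are determined by `Ψ z`. -/
theorem eq_zero_of_partialOut_mulVec_eq_zero [DecidableEq r]
    (hf : Function.Bijective (Sum.elim fe fl)) (hker : ∀ z, Ψ *ᵥ z = 0 → z ∘ fe = 0)
    {a : e → ℝ} (ha : (1 - Ψ.submatrix id fl * pinv (Ψ.submatrix id fl)) *ᵥ
      (Ψ.submatrix id fe *ᵥ a) = 0) : a = 0 := by
  let φ := Equiv.ofBijective _ hf
  let z : c → ℝ := Sum.elim a (-(pinv (Ψ.submatrix id fl) *ᵥ (Ψ.submatrix id fe *ᵥ a))) ∘ φ.symm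
  have h1 : z ∘ fe = a := by
    ext i
    have : φ.symm (fe i) = Sum.inl i := by
      rw [Equiv.symm_apply_eq]; rfl
    simp [z, this]
  have h2 : z ∘ fl = -(pinv (Ψ.submatrix id fl) *ᵥ (Ψ.submatrix id fe *ᵥ a)) := by
    ext i
    have : φ.symm (fl i) = Sum.inr i := by
      rw [Equiv.symm_apply_eq]; rfl
    simp [z, this]
  rw [← h1]
  apply hker
  rw [mulVec_eq_add_of_bijective hf, h1, h2, ← ha, sub_mulVec, one_mulVec, mulVec_neg,
    mulVec_mulVec, sub_eq_add_neg]

/-- The Gram matrix of the columns `fe` after the columns `fl` have been partialled out is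
invertible. -/
theorem pinv_partialOut_gram_mul [DecidableEq r] [DecidableEq e]
    (hf : Function.Bijective (Sum.elim fe fl)) (hker : ∀ z, Ψ *ᵥ z = 0 → z ∘ fe = 0)
    {M : Matrix r r ℝ} (hM : M = 1 - Ψ.submatrix id fl * pinv (Ψ.submatrix id fl)) :
    pinv ((Ψ.submatrix id fe)ᵀ * M * Ψ.submatrix id fe) *
      ((Ψ.submatrix id fe)ᵀ * M * Ψ.submatrix id fe) = 1 := by
  apply pinv_mul_self_of_injective
  intro a ha
  have hsym : Mᵀ = M := hM ▸ one_sub_pinv_transpose _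
  have hidem : M * M = M := hM ▸ one_sub_pinv_idem _
  refine eq_zero_of_partialOut_mulVec_eq_zero hf hker (a := a) ?_
  rw [← hM, ← dotProduct_self_eq_zero]
  have : (M *ᵥ (Ψ.submatrix id fe *ᵥ a)) ⬝ᵥ (M *ᵥ (Ψ.submatrix id fe *ᵥ a)) =
      a ⬝ᵥ ((Ψ.submatrix id fe)ᵀ * M * Ψ.submatrix id fe) *ᵥ a := by
    conv_lhs => rw [dotProduct_mulVec, ← mulVec_transpose, mulVec_mulVec, hsym, hidem,
      dotProduct_mulVec, ← mulVec_transpose, dotProduct_comm, mulVec_mulVec, mulVec_mulVec]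
  rw [this, ha, dotProduct_zero]

/-- Frisch-Waugh-Lovell: the coordinates `fe` of the least-squares solution `Ψ⁺ w` are the
least-squares solution for the columns `fe` after the columns `fl` have been partialled out. -/
theorem pinv_mulVec_comp_eq [DecidableEq r] [DecidableEq e]
    (hf : Function.Bijective (Sum.elim fe fl)) (hker : ∀ z, Ψ *ᵥ z = 0 → z ∘ fe = 0)
    {M : Matrix r r ℝ} (hM : M = 1 - Ψ.submatrix id fl * pinv (Ψ.submatrix id fl))
    (w : r → ℝ) :
    (pinv Ψ *ᵥ w) ∘ fe = (pinv ((Ψ.submatrix id fe)ᵀ * M * Ψ.submatrix id fe) *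
      ((Ψ.submatrix id fe)ᵀ * M)) *ᵥ w := by
  set Ψe := Ψ.submatrix id fe with hΨe
  set Ψl := Ψ.submatrix id fl with hΨl
  set a := pinv Ψ *ᵥ w with ha
  -- the residual of the full fit is orthogonal to all columns of `Ψ`
  have hres : Ψᵀ *ᵥ (w - Ψ *ᵥ a) = 0 := by
    have := congrArg (· *ᵥ w) (transpose_mul_one_sub_pinv Ψ)
    simpa [← mulVec_mulVec, sub_mulVec] using this
  have hl : Ψlᵀ *ᵥ (w - Ψ *ᵥ a) = 0 := by
    ext i; exact congrFun hres (fl i)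
  have he : Ψeᵀ *ᵥ (w - Ψ *ᵥ a) = 0 := by
    ext i; exact congrFun hres (fe i)
  have hMl : M * Ψl = 0 := hM ▸ one_sub_pinv_mul _
  have hMw : M *ᵥ (w - Ψ *ᵥ a) = w - Ψ *ᵥ a := by
    have h0 : Ψl * pinv Ψl = (pinv Ψl)ᵀ * Ψlᵀ := by
      rw [← transpose_mul, (pinv_spec Ψl).symm_left]
    rw [hM, h0, sub_mulVec, ← mulVec_mulVec, hl, mulVec_zero, one_mulVec, sub_zero]
  have h1 : (Ψeᵀ * M * Ψe) *ᵥ (a ∘ fe) = (Ψeᵀ * M) *ᵥ w := by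
    rw [eq_comm, ← sub_eq_zero]
    rw [← hMw, mulVec_mulVec] at he
    rw [← he, mulVec_sub, mulVec_eq_add_of_bijective hf a, mulVec_add, mulVec_mulVec,
      mulVec_mulVec, ← hΨl, Matrix.mul_assoc Ψeᵀ M Ψl, hMl, Matrix.mul_zero, zero_mulVec,
      add_zero]
  calc a ∘ fe = (pinv (Ψeᵀ * M * Ψe) * (Ψeᵀ * M * Ψe)) *ᵥ (a ∘ fe) := by
        rw [pinv_partialOut_gram_mul hf hker hM, one_mulVec]
    _ = _ := by rw [← mulVec_mulVec, h1, mulVec_mulVec]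

theorem pinv_transpose (A : Matrix r c ℝ) : pinv Aᵀ = (pinv A)ᵀ := by
  obtain ⟨h1, h2, h3, h4⟩ := pinv_spec A
  refine (pinv_spec Aᵀ).unique ⟨?_, ?_, ?_, ?_⟩
  · rw [← transpose_mul, ← transpose_mul, ← Matrix.mul_assoc, h1]
  · rw [← transpose_mul, ← transpose_mul, ← Matrix.mul_assoc, h2]
  · rw [← transpose_mul, h4, h4]
  · rw [← transpose_mul, h3, h3]

/-- With `R = G⁻¹ Ψ_eᵀ M` the coordinates `fe` of `Ψ⁺` and `G = Ψ_eᵀ M Ψ_e`, one has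
`R Rᵀ = G⁻¹`. -/
theorem l2norm_partialOut_transpose_mulVec_sq [DecidableEq r] [DecidableEq e]
    (hf : Function.Bijective (Sum.elim fe fl)) (hker : ∀ z, Ψ *ᵥ z = 0 → z ∘ fe = 0)
    {M : Matrix r r ℝ} (hM : M = 1 - Ψ.submatrix id fl * pinv (Ψ.submatrix id fl))
    (h : e → ℝ) :
    l2norm ((pinv ((Ψ.submatrix id fe)ᵀ * M * Ψ.submatrix id fe) *
      ((Ψ.submatrix id fe)ᵀ * M))ᵀ *ᵥ h) ^ 2 =
      h ⬝ᵥ pinv ((Ψ.submatrix id fe)ᵀ * M * Ψ.submatrix id fe) *ᵥ h := by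
  have hsym : Mᵀ = M := hM ▸ one_sub_pinv_transpose _
  have hidem : M * M = M := hM ▸ one_sub_pinv_idem _
  have hG := pinv_partialOut_gram_mul hf hker hM
  set Ψe := Ψ.submatrix id fe with hΨe
  set G := Ψeᵀ * M * Ψe with hGdef
  have hGs : Gᵀ = G := by
    simp only [hGdef, transpose_mul, transpose_transpose, hsym, Matrix.mul_assoc]
  have hX : (pinv G)ᵀ = pinv G := by rw [← pinv_transpose, hGs]
  have : (pinv G * (Ψeᵀ * M)) * (pinv G * (Ψeᵀ * M))ᵀ = pinv G := by
    calc (pinv G * (Ψeᵀ * M)) * (pinv G * (Ψeᵀ * M))ᵀ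
        = pinv G * (Ψeᵀ * (M * M) * Ψe) * pinv G := by
          simp only [transpose_mul, transpose_transpose, hsym, hX, Matrix.mul_assoc]
      _ = pinv G := by rw [hidem, ← hGdef, hG, Matrix.one_mul]
  rw [l2norm_sq, dotProduct_mulVec, ← mulVec_transpose, transpose_transpose, mulVec_mulVec, this,
    dotProduct_comm]

end partialOut

/-! ### The forced response and the delays -/

variable {n m p : ℕ}

/-- The output at time `k` from the zero initial state under the signal `w` of the inputs
in `S`. -/
def LinSys.forced (sys : LinSys n m p) (S : Finset (Fin m)) (w : ℕ → S → ℝ) (k : ℕ) (i : Fin p) :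
    ℝ :=
  ∑ l ∈ Finset.range (k + 1), ∑ j : S, sys.markov (k - l) i j * w l j

theorem LinSys.impulseSet_mulVec (sys : LinSys n m p) (S : Finset (Fin m)) (L : ℕ)
    (w : ℕ → S → ℝ) (ki : Fin L × Fin p) :
    (sys.impulseSet L S *ᵥ fun lj => w lj.1 lj.2) ki = sys.forced S w ki.1 ki.2 := by
  obtain ⟨k, i⟩ := ki
  simp only [mulVec, dotProduct, LinSys.impulseSet, LinSys.impulse, of_apply, Fintype.sum_prod_type,
    LinSys.forced]
  have h1 : ∀ l : Fin L, ∑ j : S,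
      (if l ≤ k then sys.markov ((k : ℕ) - (l : ℕ)) i j else 0) * w l j =
      (fun a : ℕ => if a ≤ k then ∑ j : S, sys.markov ((k : ℕ) - a) i j * w a j else 0) l := by
    intro l
    by_cases h : l ≤ k
    · simp [h]
    · have h' : ¬ (l : ℕ) ≤ k := h
      simp [h, h']
  rw [Finset.sum_congr rfl fun l _ => h1 l,
    Fin.sum_univ_eq_sum_range
      (fun a : ℕ => if a ≤ k then ∑ j : S, sys.markov ((k : ℕ) - a) i j * w a j else 0) L,
    ← Finset.sum_filter]
  congr 1
  ext a
  simp only [Finset.mem_filter, Finset.mem_range]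
  have := k.2
  omega

/-- Extension by zero of a finite batch to a signal. -/
def extendSignal {L : ℕ} {S : Finset (Fin m)} (z : Fin L × S → ℝ) (l : ℕ) (j : S) : ℝ :=
  if h : l < L then z (⟨l, h⟩, j) else 0

theorem extendSignal_coe {L : ℕ} {S : Finset (Fin m)} (z : Fin L × S → ℝ) :
    (fun lj : Fin L × S => extendSignal z lj.1 lj.2) = z := by
  ext ⟨l, j⟩
  simp [extendSignal]

theorem LinSys.forced_shift (sys : LinSys n m p) (S : Finset (Fin m)) (w : ℕ → S → ℝ) (a k : ℕ)
    (hw : ∀ l < a, w l = 0) (i : Fin p) :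
    sys.forced S w (a + k) i = sys.forced S (fun l => w (a + l)) k i := by
  unfold LinSys.forced
  rw [add_assoc, Finset.sum_range_add, Finset.sum_eq_zero, zero_add]
  · simp [Nat.add_sub_add_left]
  · intro l hl
    simp [hw l (Finset.mem_range.1 hl)]

theorem exists_mem_le_of_iInf_le {s : Set ℕ} {N : ℕ} (h : ⨅ k ∈ s, (k : ℕ∞) ≤ N) :
    ∃ k ∈ s, k ≤ N := by
  have h1 : ⨅ k ∈ s, (k : ℕ∞) < ((N + 1 : ℕ) : ℕ∞) :=
    lt_of_le_of_lt h (by exact_mod_cast Nat.lt_succ_self N)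
  simp only [iInf_lt_iff] at h1
  obtain ⟨k, hk, hlt⟩ := h1
  exact ⟨k, hk, Nat.lt_succ_iff.1 (by exact_mod_cast hlt)⟩

/-- Delayed left invertibility: if the first `d + 1` outputs from the zero state vanish, where `d`
is the input delay, then the input at time `0` vanishes. -/
theorem LinSys.input_zero_of_forced_eq_zero (sys : LinSys n m p) {S : Finset (Fin m)} {d : ℕ}
    (hd : sys.inputDelay S = d) (w : ℕ → S → ℝ) (hw : ∀ k ≤ d, ∀ i, sys.forced S w k i = 0) :
    w 0 = 0 := by
  have hrank : (sys.impulseSet (d + 1) S).rank = (sys.impulseSet d S).rank + S.card := by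
    obtain ⟨k, hk, hkd⟩ := exists_mem_le_of_iInf_le (N := d) hd.le
    have : (d : ℕ∞) ≤ k := hd ▸ iInf₂_le k hk
    have : d ≤ k := by exact_mod_cast this
    obtain rfl : k = d := le_antisymm hkd this
    exact hk
  -- delaying a batch by one step maps kernel to kernel
  let E : (Fin d × S → ℝ) →ₗ[ℝ] (Fin (d + 1) × S → ℝ) :=
    { toFun := fun z lj => Fin.cases (motive := fun _ => ℝ) 0 (fun l => z (l, lj.2)) lj.1
      map_add' := by
        intro y z
        ext ⟨l, j⟩
        refine Fin.cases ?_ (fun l => ?_) l <;> simp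
      map_smul' := by
        intro t z
        ext ⟨l, j⟩
        refine Fin.cases ?_ (fun l => ?_) l <;> simp }
  have hE : Function.Injective E := by
    intro y z hyz
    ext ⟨l, j⟩
    simpa [E] using congrFun hyz (l.succ, j)
  have hker : ∀ z, sys.impulseSet d S *ᵥ z = 0 → sys.impulseSet (d + 1) S *ᵥ E z = 0 := by
    intro z hz
    let w' : ℕ → S → ℝ := fun l j => if l = 0 then 0 else extendSignal z (l - 1) j
    have hEz : E z = fun lj => w' lj.1 lj.2 := by
      ext ⟨l, j⟩
      refine Fin.cases ?_ (fun l => ?_) l <;> simp [E, w', extendSignal]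
    rw [hEz]
    ext ⟨k, i⟩
    rw [sys.impulseSet_mulVec]
    rcases Nat.eq_zero_or_pos k with hk | hk
    · simp [LinSys.forced, hk, w']
    · obtain ⟨k', hk'⟩ : ∃ k', (k : ℕ) = 1 + k' := ⟨k - 1, by omega⟩
      have hlt : k' < d := by have := k.2; omega
      have h0 : ∀ l < 1, w' l = 0 := by
        intro l hl
        obtain rfl : l = 0 := by omega
        ext j; simp [w']
      have h1 : (fun l => w' (1 + l)) = extendSignal z := by
        ext l j; simp [w']
      have h2 := sys.impulseSet_mulVec S d (extendSignal z) (⟨k', hlt⟩, i)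
      rw [extendSignal_coe, hz] at h2
      simp only [hk']
      rw [sys.forced_shift S w' 1 k' h0, h1, ← h2]
      rfl
  have hz : sys.impulseSet (d + 1) S *ᵥ (fun lj => w lj.1 lj.2) = 0 := by
    ext ⟨k, i⟩
    rw [sys.impulseSet_mulVec]
    exact hw k (Nat.lt_succ_iff.1 k.2) i
  obtain ⟨y, hy⟩ := exists_eq_of_mulVec_eq_zero _ _ E hE hker
    (by simp only [hrank, Fintype.card_prod, Fintype.card_fin, Fintype.card_coe]; ring) hz
  ext j
  have := congrFun hy (0, j)
  simpa [E] using this.symm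

theorem LinSys.input_eq_zero_of_forced_eq_zero (sys : LinSys n m p) {S : Finset (Fin m)} {d N : ℕ}
    (hd : sys.inputDelay S = d) (w : ℕ → S → ℝ) (hw : ∀ k ≤ N, ∀ i, sys.forced S w k i = 0)
    (l : ℕ) (hl : l + d ≤ N) : w l = 0 := by
  induction l using Nat.strong_induction_on with
  | _ l ih =>
    refine sys.input_zero_of_forced_eq_zero hd (fun a => w (l + a)) fun k hk i => ?_
    rw [← sys.forced_shift S w l k fun a ha => ih a ha (by omega)]
    exact hw _ (by omega) i

/-- If `N` is at least the state delay, then the outputs at the times `0, …, N` determine the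
initial state. -/
theorem LinSys.state_eq_zero_of_output_eq_zero (sys : LinSys n m p) {S : Finset (Fin m)} {N : ℕ}
    (hN : sys.stateDelay S ≤ N) (x : Fin n → ℝ) (w : ℕ → S → ℝ)
    (hw : ∀ k ≤ N, ∀ i, ((sys.C * sys.A ^ k) *ᵥ x) i + sys.forced S w k i = 0) : x = 0 := by
  obtain ⟨k, hk, hkN⟩ := exists_mem_le_of_iInf_le hN
  have hrank : (sys.Psi (k + 1) S).rank = (sys.impulseSet (k + 1) S).rank + n := hk
  let E : (Fin (k + 1) × S → ℝ) →ₗ[ℝ] (Fin n ⊕ (Fin (k + 1) × S) → ℝ) :=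
    { toFun := fun z => Sum.elim 0 z
      map_add' := by
        intro y z; ext (s | s) <;> simp
      map_smul' := by
        intro y z; ext (s | s) <;> simp }
  have hE : Function.Injective E := by
    intro y z hyz
    ext s
    simpa [E] using congrFun hyz (Sum.inr s)
  have hker : ∀ z, sys.impulseSet (k + 1) S *ᵥ z = 0 → sys.Psi (k + 1) S *ᵥ E z = 0 := by
    intro z hz
    have h1 : E z ∘ Sum.inl = 0 := rfl
    have h2 : E z ∘ Sum.inr = z := rfl
    rw [LinSys.Psi, fromCols_mulVec, h1, h2, hz, mulVec_zero, add_zero]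
  have hz : sys.Psi (k + 1) S *ᵥ (Sum.elim x fun lj => w lj.1 lj.2) = 0 := by
    rw [LinSys.Psi, fromCols_mulVec, Sum.elim_comp_inl, Sum.elim_comp_inr]
    ext ⟨l, i⟩
    rw [Pi.add_apply, sys.impulseSet_mulVec]
    exact hw l (by have := l.2; omega) i
  obtain ⟨y, hy⟩ := exists_eq_of_mulVec_eq_zero _ _ E hE hker
    (by simp only [hrank, Fintype.card_prod, Fintype.card_fin, Fintype.card_coe,
      Fintype.card_sum]; ring) hz
  ext s
  have := congrFun hy (Sum.inl s)
  simpa [E] using this.symm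

/-- The index of a column of `Ψ_{S,[N:d]}` as a column of `Ψ_S`. -/
def earlyIndex (N d : ℕ) (S : Finset (Fin m)) :
    Fin n ⊕ (EarlyTime N d × S) → Fin n ⊕ (Fin (N + 1) × S) :=
  Sum.map id (Prod.map Subtype.val id)

/-- The index of a column of `Ψ_{S,[d-1:0]}` as a column of `Ψ_S`. -/
def lateIndex (N d : ℕ) (S : Finset (Fin m)) :
    LateTime N d × S → Fin n ⊕ (Fin (N + 1) × S) :=
  fun lj => Sum.inr (lj.1.val, lj.2)

theorem bijective_earlyIndex_lateIndex (N d : ℕ) (S : Finset (Fin m)) :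
    Function.Bijective (Sum.elim (earlyIndex (n := n) N d S) (lateIndex N d S)) := by
  constructor
  · rintro ((s | ⟨k, j⟩) | ⟨k, j⟩) ((s' | ⟨k', j'⟩) | ⟨k', j'⟩) h
    all_goals simp [earlyIndex, lateIndex, Subtype.val_inj] at h
    all_goals first
      | (obtain ⟨h1, rfl⟩ := h
         first
          | (obtain rfl := h1; rfl)
          | (have h2 := k.2; have h3 := k'.2; rw [h1] at h2; omega))
      | (obtain rfl := h; rfl)
  · rintro (s | ⟨k, j⟩)
    · exact ⟨Sum.inl (Sum.inl s), rfl⟩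
    · by_cases h : (k : ℕ) + d ≤ N
      · exact ⟨Sum.inl (Sum.inr (⟨k, h⟩, j)), rfl⟩
      · exact ⟨Sum.inr (⟨k, not_le.1 h⟩, j), rfl⟩

/-- The batch of measurements determines the initial state and the inputs up to time `N - d`. -/
theorem LinSys.comp_earlyIndex_eq_zero (sys : LinSys n m p) {S : Finset (Fin m)} {d N : ℕ}
    (hd : sys.inputDelay S = d) (hN : max (sys.inputDelay S) (sys.stateDelay S) ≤ N)
    (z : Fin n ⊕ (Fin (N + 1) × S) → ℝ) (hz : sys.Psi (N + 1) S *ᵥ z = 0) :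
    z ∘ earlyIndex N d S = 0 := by
  set w := extendSignal (z ∘ Sum.inr) with hwdef
  have hout : ∀ k ≤ N, ∀ i, ((sys.C * sys.A ^ k) *ᵥ (z ∘ Sum.inl)) i + sys.forced S w k i = 0 := by
    intro k hk i
    have := congrFun hz (⟨k, Nat.lt_succ_iff.2 hk⟩, i)
    rw [LinSys.Psi, fromCols_mulVec, ← extendSignal_coe (z ∘ Sum.inr), Pi.add_apply,
      sys.impulseSet_mulVec] at this
    exact this
  have hx := sys.state_eq_zero_of_output_eq_zero ((le_max_right _ _).trans hN) _ w hout
  have hw := sys.input_eq_zero_of_forced_eq_zero (N := N) hd w fun k hk i => by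
    simpa [hx] using hout k hk i
  ext (s | ⟨k, j⟩)
  · exact congrFun hx s
  · have := congrFun (hw k.1 k.2) j
    have hk : (k.1 : ℕ) ≤ N := Nat.lt_succ_iff.1 k.1.2
    simpa [hwdef, extendSignal, earlyIndex, hk] using this

theorem LinSys.pinv_mulVec_mulVec_comp_earlyIndex (sys : LinSys n m p) {S : Finset (Fin m)}
    {d N : ℕ} (hd : sys.inputDelay S = d) (hN : max (sys.inputDelay S) (sys.stateDelay S) ≤ N)
    (z : Fin n ⊕ (Fin (N + 1) × S) → ℝ) :
    (pinv (sys.Psi (N + 1) S) *ᵥ (sys.Psi (N + 1) S *ᵥ z)) ∘ earlyIndex N d S =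
      z ∘ earlyIndex N d S := by
  have h0 : sys.Psi (N + 1) S *ᵥ
      (pinv (sys.Psi (N + 1) S) *ᵥ (sys.Psi (N + 1) S *ᵥ z) - z) = 0 := by
    rw [mulVec_sub, mulVec_mulVec, mulVec_mulVec, (pinv_spec _).mul_mul_self, sub_self]
  have := sys.comp_earlyIndex_eq_zero hd hN _ h0
  ext c
  exact sub_eq_zero.1 (congrFun this c)

/-! ### The measurements in batch form -/

theorem LinSys.state_eq (sys : LinSys n m p) (x0 : Fin n → ℝ) (u : ℕ → Fin m → ℝ) (k : ℕ) :
    sys.state x0 u k = sys.A ^ k *ᵥ x0 +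
      ∑ l ∈ Finset.range k, (sys.A ^ (k - 1 - l) * sys.B) *ᵥ u l := by
  induction k with
  | zero => simp [LinSys.state]
  | succ k ih =>
    rw [LinSys.state, ih, mulVec_add, mulVec_mulVec, ← pow_succ', Finset.sum_range_succ,
      Matrix.mulVec_sum, add_assoc]
    simp only [Nat.add_sub_cancel, Nat.sub_self, pow_zero, Matrix.one_mul]
    congr 2
    refine Finset.sum_congr rfl fun l hl => ?_
    have : k - l = (k - 1 - l) + 1 := by
      have := Finset.mem_range.1 hl
      omega
    rw [this, mulVec_mulVec, pow_succ', Matrix.mul_assoc]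

theorem LinSys.markov_zero (sys : LinSys n m p) : sys.markov 0 = 0 := rfl

theorem LinSys.markov_succ (sys : LinSys n m p) (l : ℕ) :
    sys.markov (l + 1) = sys.C * sys.A ^ l * sys.B := rfl

theorem LinSys.output_eq (sys : LinSys n m p) (x0 : Fin n → ℝ) (u : ℕ → Fin m → ℝ) (k : ℕ) :
    sys.C *ᵥ sys.state x0 u k = (sys.C * sys.A ^ k) *ᵥ x0 +
      ∑ l ∈ Finset.range (k + 1), sys.markov (k - l) *ᵥ u l := by
  rw [sys.state_eq, mulVec_add, mulVec_mulVec, Finset.sum_range_succ, Matrix.mulVec_sum]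
  simp only [Nat.sub_self, sys.markov_zero, zero_mulVec, add_zero]
  congr 1
  refine Finset.sum_congr rfl fun l hl => ?_
  have : k - l = (k - 1 - l) + 1 := by
    have := Finset.mem_range.1 hl
    omega
  rw [this, mulVec_mulVec, sys.markov_succ, Matrix.mul_assoc]

/-- The true values of the unknowns that `Ψ_S` multiplies. -/
def batchTruth (N : ℕ) (S : Finset (Fin m)) (x0 : Fin n → ℝ) (u : ℕ → Fin m → ℝ) :
    Fin n ⊕ (Fin (N + 1) × S) → ℝ :=
  Sum.elim x0 fun lj => u lj.1 lj.2

theorem apply_eq_zero_of_notMem_activeSet {N : ℕ} {u : ℕ → Fin m → ℝ} {j : Fin m}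
    (hj : j ∉ activeSet N u) {k : ℕ} (hk : k ≤ N) : u k j = 0 := by
  by_contra h
  exact hj (by simpa [activeSet] using ⟨k, hk, h⟩)

theorem LinSys.measurement_eq (sys : LinSys n m p) (N : ℕ) (x0 : Fin n → ℝ) (u : ℕ → Fin m → ℝ)
    (v : Fin (N + 1) × Fin p → ℝ) :
    sys.measurement (N + 1) x0 u v =
      sys.Psi (N + 1) (activeSet N u) *ᵥ batchTruth N (activeSet N u) x0 u + v := by
  ext ⟨k, i⟩
  rw [LinSys.Psi, fromCols_mulVec, Pi.add_apply, Pi.add_apply, LinSys.measurement, batchTruth,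
    Sum.elim_comp_inl, Sum.elim_comp_inr,
    sys.impulseSet_mulVec (activeSet N u) (N + 1) (fun l j => u l j) (k, i), sys.output_eq,
    Pi.add_apply]
  congr 2
  rw [LinSys.forced, Finset.sum_apply]
  refine Finset.sum_congr rfl fun l hl => ?_
  rw [mulVec, dotProduct,
    Finset.sum_coe_sort (activeSet N u) fun j => sys.markov (k - l) i j * u l j]
  symm
  refine Finset.sum_subset (Finset.subset_univ _) fun j _ hj => ?_
  have h1 := Finset.mem_range.1 hl
  have h2 := k.2
  rw [apply_eq_zero_of_notMem_activeSet hj (by simp only at h1; omega), mul_zero]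

/-! ### Optimality conditions for the group LASSO -/

section optimality

variable {r s t κ : Type*} [Fintype s] [Fintype t] [Fintype κ]

/-- The residual `y - O x - ∑ j, J_j u_j` of a group regression. -/
def residual (O : Matrix r s ℝ) (J : κ → Matrix r t ℝ) (y : r → ℝ) (x : s → ℝ) (u : κ → t → ℝ) :
    r → ℝ :=
  y - O *ᵥ x - ∑ j, J j *ᵥ u j

variable {T lam : ℝ} {O : Matrix r s ℝ} {J : κ → Matrix r t ℝ} {y : r → ℝ}
  {x : s → ℝ} {u : κ → t → ℝ}

theorem residual_add_smul (x' : s → ℝ) (u' : κ → t → ℝ) (ε : ℝ) :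
    residual O J y (x + ε • (x' - x)) (u + ε • (u' - u)) =
      residual O J y x u - ε • (O *ᵥ (x' - x) + ∑ j, J j *ᵥ (u' j - u j)) := by
  simp only [residual, mulVec_add, mulVec_smul, Pi.add_apply, Pi.smul_apply, Pi.sub_apply,
    Finset.sum_add_distrib, ← Finset.smul_sum, smul_add]
  abel

variable [Fintype r]

/-- The objective of a group regression with unpenalized block `O`, penalized blocks `J j` and
normalization `T`. -/
noncomputable def groupObjective (T lam : ℝ) (O : Matrix r s ℝ) (J : κ → Matrix r t ℝ) (y : r → ℝ)
    (x : s → ℝ) (u : κ → t → ℝ) : ℝ :=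
  1 / (2 * T) * l2norm (residual O J y x u) ^ 2 + lam * ∑ j, l2norm (u j)

/-- `(x, u)` minimizes the group regression objective among the points whose penalized blocks
outside `S` vanish, and it is such a point. -/
def IsRestrictedMin (T lam : ℝ) (O : Matrix r s ℝ) (J : κ → Matrix r t ℝ) (y : r → ℝ)
    (S : Finset κ) (x : s → ℝ) (u : κ → t → ℝ) : Prop :=
  (∀ j ∉ S, u j = 0) ∧ ∀ x' u', (∀ j ∉ S, u' j = 0) →
    groupObjective T lam O J y x u ≤ groupObjective T lam O J y x' u'

theorem l2norm_sub_smul_sq {ι : Type*} [Fintype ι] (f g : ι → ℝ) (ε : ℝ) :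
    l2norm (f - ε • g) ^ 2 = l2norm f ^ 2 - 2 * ε * (f ⬝ᵥ g) + ε ^ 2 * l2norm g ^ 2 := by
  simp only [l2norm_sq, sub_dotProduct, dotProduct_sub, smul_dotProduct, dotProduct_smul,
    smul_eq_mul, dotProduct_comm g f]
  ring

/-- First-order optimality of a restricted minimizer, as a variational inequality. -/
theorem IsRestrictedMin.variational_inequality (hT : 0 < T) (hlam : 0 ≤ lam) {S : Finset κ}
    (h : IsRestrictedMin T lam O J y S x u) (x' : s → ℝ) (u' : κ → t → ℝ)
    (hu' : ∀ j ∉ S, u' j = 0) :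
    residual O J y x u ⬝ᵥ (O *ᵥ (x' - x) + ∑ j, J j *ᵥ (u' j - u j)) ≤
      T * lam * ∑ j, (l2norm (u' j) - l2norm (u j)) := by
  obtain ⟨hu, hmin⟩ := h
  set D := O *ᵥ (x' - x) + ∑ j, J j *ᵥ (u' j - u j) with hD
  set ρ := residual O J y x u with hρ
  set Δ := ∑ j, (l2norm (u' j) - l2norm (u j)) with hΔ
  -- move from `(x, u)` a fraction `ε` of the way to `(x', u')`
  have key : ∀ ε : ℝ, 0 < ε → ε ≤ 1 → ρ ⬝ᵥ D - T * lam * Δ ≤ ε * l2norm D ^ 2 / 2 := by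
    intro ε hε hε1
    have h1 := hmin (x + ε • (x' - x)) (u + ε • (u' - u)) fun j hj => by
      simp [hu j hj, hu' j hj]
    rw [groupObjective, groupObjective, residual_add_smul, ← hρ, ← hD, l2norm_sub_smul_sq] at h1
    have h2 : ∑ j, l2norm ((u + ε • (u' - u)) j) ≤ ∑ j, l2norm (u j) + ε * Δ := by
      rw [hΔ, Finset.mul_sum, ← Finset.sum_add_distrib]
      refine Finset.sum_le_sum fun j _ => ?_
      have e : (u + ε • (u' - u)) j = (1 - ε) • u j + ε • u' j := by
        ext a; simp; ring
      rw [e]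
      refine (l2norm_add_le _ _).trans (le_of_eq ?_)
      rw [l2norm_smul, l2norm_smul, abs_of_pos hε, abs_of_nonneg (by linarith)]
      ring
    have h3 := mul_le_mul_of_nonneg_left h2 hlam
    have h4 : 1 / (2 * T) * l2norm ρ ^ 2 ≤ 1 / (2 * T) * (l2norm ρ ^ 2 - 2 * ε * (ρ ⬝ᵥ D) +
        ε ^ 2 * l2norm D ^ 2) + lam * (ε * Δ) := by linarith
    have h5 := mul_le_mul_of_nonneg_left h4 hT.le
    have h6 : ε * (ρ ⬝ᵥ D - T * lam * Δ) ≤ ε * (ε * l2norm D ^ 2 / 2) := by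
      have e1 : T * (1 / (2 * T) * l2norm ρ ^ 2) = l2norm ρ ^ 2 / 2 := by field_simp
      have e2 : T * (1 / (2 * T) * (l2norm ρ ^ 2 - 2 * ε * (ρ ⬝ᵥ D) + ε ^ 2 * l2norm D ^ 2) +
          lam * (ε * Δ)) = (l2norm ρ ^ 2 - 2 * ε * (ρ ⬝ᵥ D) + ε ^ 2 * l2norm D ^ 2) / 2 +
            T * lam * ε * Δ := by field_simp
      rw [e1, e2] at h5
      linarith
    exact le_of_mul_le_mul_left h6 hε
  by_contra hcon
  push Not at hcon
  set A := ρ ⬝ᵥ D - T * lam * Δ with hA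
  have hApos : 0 < A := by linarith
  set Q := l2norm D ^ 2 with hQ
  have hQ0 : 0 ≤ Q := sq_nonneg _
  have h1 := key (min 1 (A / (Q + 1))) (lt_min one_pos (by positivity)) (min_le_left _ _)
  have h2 : min 1 (A / (Q + 1)) * Q ≤ A := by
    calc min 1 (A / (Q + 1)) * Q ≤ A / (Q + 1) * (Q + 1) :=
          mul_le_mul (min_le_right _ _) (by linarith) hQ0 (by positivity)
      _ = A := by field_simp
  linarith

theorem IsRestrictedMin.transpose_mulVec_residual_eq_zero (hT : 0 < T) (hlam : 0 ≤ lam)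
    {S : Finset κ} (h : IsRestrictedMin T lam O J y S x u) :
    Oᵀ *ᵥ residual O J y x u = 0 := by
  have h1 := h.variational_inequality hT hlam (x + Oᵀ *ᵥ residual O J y x u) u h.1
  simp only [add_sub_cancel_left, sub_self, mulVec_zero, Finset.sum_const_zero, add_zero,
    mul_zero] at h1
  rw [dotProduct_mulVec, ← mulVec_transpose] at h1
  exact dotProduct_self_eq_zero.1 (le_antisymm h1 (by rw [← l2norm_sq]; positivity))

/-- The optimality condition in one penalized block: `J_jᵀ ρ / (T lam)` is a subgradient of the
Euclidean norm at `u j`. -/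
theorem IsRestrictedMin.block_inequality (hT : 0 < T) (hlam : 0 ≤ lam)
    {S : Finset κ} (h : IsRestrictedMin T lam O J y S x u) {j : κ} (hj : j ∈ S) (w : t → ℝ) :
    ((J j)ᵀ *ᵥ residual O J y x u) ⬝ᵥ (w - u j) ≤ T * lam * (l2norm w - l2norm (u j)) := by
  classical
  have h1 := h.variational_inequality hT hlam x (Function.update u j w) fun i hi => by
    rw [Function.update_of_ne (by rintro rfl; exact hi hj), h.1 i hi]
  rw [Finset.sum_eq_single j, Finset.sum_eq_single j] at h1
  · rw [mulVec_transpose, ← dotProduct_mulVec]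
    simpa only [sub_self, mulVec_zero, zero_add, Function.update_self] using h1
  all_goals simp +contextual

theorem IsRestrictedMin.l2norm_block_le (hT : 0 < T) (hlam : 0 ≤ lam)
    {S : Finset κ} (h : IsRestrictedMin T lam O J y S x u) {j : κ} (hj : j ∈ S) :
    l2norm ((J j)ᵀ *ᵥ residual O J y x u) ≤ T * lam := by
  refine l2norm_le_of_forall_dotProduct_le (by positivity) fun w => ?_
  have h1 := h.block_inequality hT hlam hj (u j + w)
  rw [add_sub_cancel_left] at h1
  refine h1.trans (mul_le_mul_of_nonneg_left ?_ (by positivity))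
  linarith [l2norm_add_le (u j) w]

/-- Strict dual feasibility outside `S` makes a minimizer restricted to `S` a global minimizer,
and every global minimizer then vanishes outside `S`. -/
theorem IsRestrictedMin.global (hT : 0 < T) (hlam : 0 ≤ lam)
    {S : Finset κ} (h : IsRestrictedMin T lam O J y S x u)
    (hdual : ∀ j ∉ S, l2norm ((J j)ᵀ *ᵥ residual O J y x u) < T * lam) :
    (∀ x' u', groupObjective T lam O J y x u ≤ groupObjective T lam O J y x' u') ∧
    ∀ x' u', (∀ x'' u'', groupObjective T lam O J y x' u' ≤ groupObjective T lam O J y x'' u'') →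
      ∀ j ∉ S, u' j = 0 := by
  set ρ := residual O J y x u with hρ
  -- the slack of the subgradient inequality in block `j`
  let gap : (κ → t → ℝ) → κ → ℝ := fun u' j =>
    T * lam * (l2norm (u' j) - l2norm (u j)) - ((J j)ᵀ *ᵥ ρ) ⬝ᵥ (u' j - u j)
  have hgap_notMem : ∀ u', ∀ j ∉ S,
      (T * lam - l2norm ((J j)ᵀ *ᵥ ρ)) * l2norm (u' j) ≤ gap u' j := by
    intro u' j hj
    have := dotProduct_le_l2norm ((J j)ᵀ *ᵥ ρ) (u' j)
    simp only [gap, h.1 j hj, sub_zero, l2norm_zero]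
    linarith
  have hgap : ∀ u' j, 0 ≤ gap u' j := by
    intro u' j
    by_cases hj : j ∈ S
    · have := h.block_inequality hT hlam hj (u' j)
      simp only [gap]
      linarith
    · exact (mul_nonneg (by linarith [hdual j hj]) (l2norm_nonneg _)).trans (hgap_notMem u' j hj)
  have hsum : ∀ x' u', groupObjective T lam O J y x u + 1 / T * ∑ j, gap u' j ≤
      groupObjective T lam O J y x' u' := by
    intro x' u'
    have e1 := residual_add_smul (O := O) (J := J) (y := y) (x := x) (u := u) x' u' 1
    rw [one_smul, one_smul, add_sub_cancel, add_sub_cancel, ← hρ] at e1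
    set D := O *ᵥ (x' - x) + ∑ j, J j *ᵥ (u' j - u j) with hD
    have e2 : ρ ⬝ᵥ D = ∑ j, ((J j)ᵀ *ᵥ ρ) ⬝ᵥ (u' j - u j) := by
      have hO : ρ ⬝ᵥ O *ᵥ (x' - x) = 0 := by
        rw [dotProduct_mulVec, ← mulVec_transpose,
          h.transpose_mulVec_residual_eq_zero hT hlam, zero_dotProduct]
      rw [hD, dotProduct_add, hO, zero_add, dotProduct_sum]
      refine Finset.sum_congr rfl fun j _ => ?_
      rw [dotProduct_mulVec, ← mulVec_transpose]
    have e3 : ∑ j, gap u' j =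
        T * lam * (∑ j, l2norm (u' j) - ∑ j, l2norm (u j)) - ρ ⬝ᵥ D := by
      rw [e2, ← Finset.sum_sub_distrib, Finset.mul_sum, ← Finset.sum_sub_distrib]
    rw [groupObjective, groupObjective, e1, ← hρ, l2norm_sub_smul_sq, e3]
    have : 0 ≤ 1 / (2 * T) * (1 ^ 2 * l2norm D ^ 2) := by positivity
    have e4 : 1 / T * (T * lam * (∑ j, l2norm (u' j) - ∑ j, l2norm (u j)) - ρ ⬝ᵥ D) =
        lam * (∑ j, l2norm (u' j) - ∑ j, l2norm (u j)) - 1 / (2 * T) * (2 * (ρ ⬝ᵥ D)) := by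
      field_simp
    rw [e4]
    linarith
  refine ⟨fun x' u' => ?_, fun x' u' hmin j hj => ?_⟩
  · have : 0 ≤ 1 / T * ∑ j, gap u' j :=
      mul_nonneg (by positivity) (Finset.sum_nonneg fun j _ => hgap u' j)
    linarith [hsum x' u']
  · have h1 := hsum x' u'
    have h2 := hmin x u
    have h3 : ∑ j, gap u' j ≤ 0 := by
      have : 1 / T * ∑ j, gap u' j ≤ 0 := by linarith
      by_contra hc
      push Not at hc
      have : 0 < 1 / T * ∑ j, gap u' j := mul_pos (by positivity) hc
      linarith
    have h4 : gap u' j ≤ 0 :=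
      (Finset.single_le_sum (fun i _ => hgap u' i) (Finset.mem_univ j)).trans h3
    have h5 := (hgap_notMem u' j hj).trans h4
    by_contra hne
    have : 0 < (T * lam - l2norm ((J j)ᵀ *ᵥ ρ)) * l2norm (u' j) :=
      mul_pos (by linarith [hdual j hj]) (l2norm_pos hne)
    linarith

/-- Coercivity: the penalty controls the penalized blocks, and then the fit controls `O x`. -/
theorem exists_norm_le_of_groupObjective_le (hT : 0 < T) (hlam : 0 < lam)
    (hO : ∀ x, O *ᵥ x = 0 → x = 0) (c : ℝ) :
    ∃ R, ∀ x u, groupObjective T lam O J y x u ≤ c → ‖x‖ ≤ R ∧ ‖u‖ ≤ R := by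
  classical
  set a := c / lam
  set b := √(2 * T * c) + l2norm y + ∑ j, specNorm (J j) * a
  refine ⟨max (specNorm (pinv O) * b) a, fun x u hq => ?_⟩
  rw [groupObjective] at hq
  have hpen : 0 ≤ ∑ j, l2norm (u j) := Finset.sum_nonneg fun j _ => l2norm_nonneg _
  have hfit : 0 ≤ 1 / (2 * T) * l2norm (residual O J y x u) ^ 2 := by positivity
  have hu : ∀ j, l2norm (u j) ≤ a := by
    intro j
    have h1 := Finset.single_le_sum (f := fun j => l2norm (u j))
      (fun i _ => l2norm_nonneg _) (Finset.mem_univ j)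
    rw [le_div_iff₀ hlam]
    have := mul_le_mul_of_nonneg_left h1 hlam.le
    linarith
  have ha : 0 ≤ a := div_nonneg (by linarith [mul_nonneg hlam.le hpen]) hlam.le
  have hb : l2norm (O *ᵥ x) ≤ b := by
    have e : O *ᵥ x = -residual O J y x u + y + -∑ j, J j *ᵥ u j := by
      rw [residual]; abel
    have h1 : l2norm (residual O J y x u) ≤ √(2 * T * c) := by
      apply Real.le_sqrt_of_sq_le
      have h2 : 1 / (2 * T) * l2norm (residual O J y x u) ^ 2 ≤ c := by
        linarith [mul_nonneg hlam.le hpen]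
      calc l2norm (residual O J y x u) ^ 2
          = 2 * T * (1 / (2 * T) * l2norm (residual O J y x u) ^ 2) := by field_simp
        _ ≤ _ := mul_le_mul_of_nonneg_left h2 (by positivity)
    have h2 : l2norm (∑ j, J j *ᵥ u j) ≤ ∑ j, specNorm (J j) * a := by
      have : l2norm (∑ j, J j *ᵥ u j) ≤ ∑ j, l2norm (J j *ᵥ u j) :=
        Finset.le_sum_of_subadditive l2norm l2norm_zero.le l2norm_add_le _ _
      refine this.trans (Finset.sum_le_sum fun j _ => ?_)
      exact (l2norm_mulVec_le _ _).trans (mul_le_mul_of_nonneg_left (hu j) (specNorm_nonneg _))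
    rw [e]
    refine (l2norm_add_le _ _).trans (add_le_add ((l2norm_add_le _ _).trans
      (add_le_add ?_ le_rfl)) ?_)
    · rwa [l2norm_neg]
    · rwa [l2norm_neg]
  constructor
  · refine le_max_of_le_left ?_
    calc ‖x‖ ≤ l2norm x := norm_le_l2norm x
      _ = l2norm (pinv O *ᵥ (O *ᵥ x)) := by
        rw [mulVec_mulVec, pinv_mul_self_of_injective O hO, one_mulVec]
      _ ≤ specNorm (pinv O) * l2norm (O *ᵥ x) := l2norm_mulVec_le _ _
      _ ≤ specNorm (pinv O) * b := mul_le_mul_of_nonneg_left hb (specNorm_nonneg _)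
  · refine le_max_of_le_right ?_
    exact (pi_norm_le_iff_of_nonneg ha).2 fun j => (norm_le_l2norm _).trans (hu j)

/-- A restricted minimizer exists as soon as the unpenalized block has trivial kernel: the
objective is then coercive. -/
theorem exists_isRestrictedMin (hT : 0 < T) (hlam : 0 < lam)
    (hO : ∀ x, O *ᵥ x = 0 → x = 0) (S : Finset κ) :
    ∃ x u, IsRestrictedMin T lam O J y S x u := by
  classical
  let f : (s → ℝ) × (κ → t → ℝ) → ℝ := fun q => groupObjective T lam O J y q.1 q.2
  have hf : Continuous f := by
    have h1 : Continuous fun q : (s → ℝ) × (κ → t → ℝ) => residual O J y q.1 q.2 := by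
      unfold residual
      fun_prop
    have h2 : ∀ j, Continuous fun q : (s → ℝ) × (κ → t → ℝ) => l2norm (q.2 j) := fun j =>
      continuous_l2norm.comp (by fun_prop)
    have h3 := continuous_l2norm.comp h1
    simp only [f, groupObjective]
    exact ((h3.pow 2).const_mul _).add ((continuous_finsetSum _ fun j _ => h2 j).const_mul lam)
  let Z : Set ((s → ℝ) × (κ → t → ℝ)) := {q | (∀ j ∉ S, q.2 j = 0) ∧ f q ≤ f 0}
  have hZc : IsClosed Z := by
    have : Z = (⋂ j, ⋂ (_ : j ∉ S), {q | q.2 j = 0}) ∩ {q | f q ≤ f 0} := by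
      ext q; simp [Z]
    rw [this]
    refine IsClosed.inter (isClosed_iInter fun j => isClosed_iInter fun _ => ?_)
      (isClosed_le hf continuous_const)
    exact isClosed_eq (by fun_prop) continuous_const
  have hZb : Bornology.IsBounded Z := by
    obtain ⟨R, hR⟩ := exists_norm_le_of_groupObjective_le (J := J) (y := y) hT hlam hO (f 0)
    refine isBounded_iff_forall_norm_le.2 ⟨R, fun q hq => ?_⟩
    exact max_le (hR q.1 q.2 hq.2).1 (hR q.1 q.2 hq.2).2
  obtain ⟨q, hqZ, hq⟩ := (Metric.isCompact_of_isClosed_isBounded hZc hZb).exists_isMinOn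
    ⟨0, fun _ _ => rfl, le_rfl⟩ hf.continuousOn
  refine ⟨q.1, q.2, hqZ.1, fun x' u' hu' => ?_⟩
  by_cases hle : f (x', u') ≤ f 0
  · exact isMinOn_iff.1 hq (x', u') ⟨hu', hle⟩
  · exact le_trans (b := f 0) hqZ.2 (le_of_not_ge hle)

end optimality

/-! ### Support recovery on the good noise event -/

theorem LinSys.residual_eq (sys : LinSys n m p) (N : ℕ) {S : Finset (Fin m)}
    (y : Fin (N + 1) × Fin p → ℝ) (x : Fin n → ℝ) {u : Fin m → Fin (N + 1) → ℝ}
    (hu : ∀ j ∉ S, u j = 0) :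
    residual (sys.obs (N + 1)) (sys.impulse (N + 1)) y x u =
      y - sys.Psi (N + 1) S *ᵥ (Sum.elim x fun lj => u lj.2 lj.1) := by
  rw [residual, LinSys.Psi, fromCols_mulVec, Sum.elim_comp_inl, Sum.elim_comp_inr, sub_sub]
  congr 2
  ext ki
  simp only [Finset.sum_apply, mulVec, dotProduct, Fintype.sum_prod_type_right,
    LinSys.impulseSet, of_apply]
  rw [Finset.sum_coe_sort S fun j => ∑ l, sys.impulse (N + 1) j ki l * u j l]
  symm
  refine Finset.sum_subset (Finset.subset_univ _) fun j _ hj => ?_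
  simp [hu j hj]

theorem LinSys.Psi_transpose_mulVec (sys : LinSys n m p) (N : ℕ) (S : Finset (Fin m))
    (w : Fin (N + 1) × Fin p → ℝ) :
    (sys.Psi (N + 1) S)ᵀ *ᵥ w = Sum.elim ((sys.obs (N + 1))ᵀ *ᵥ w)
      fun lj => ((sys.impulse (N + 1) lj.2)ᵀ *ᵥ w) lj.1 := by
  ext (i | lj) <;> rfl

theorem abs_mulVec_le_rowSumNorm {r c : Type*} [Fintype r] [Fintype c] (M : Matrix r c ℝ)
    {g : c → ℝ} {b : ℝ} (hg : ∀ j, |g j| ≤ b) (i : r) :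
    |(M *ᵥ g) i| ≤ rowSumNorm M * b := by
  rcases isEmpty_or_nonempty c with hc | ⟨⟨j0⟩⟩
  · simp [mulVec, dotProduct, rowSumNorm]
  have hb : 0 ≤ b := (abs_nonneg _).trans (hg j0)
  calc |(M *ᵥ g) i| ≤ ∑ j, |M i j * g j| := Finset.abs_sum_le_sum_abs _ _
    _ ≤ ∑ j, |M i j| * b := Finset.sum_le_sum fun j _ => by
        rw [abs_mul]; exact mul_le_mul_of_nonneg_left (hg j) (abs_nonneg _)
    _ = (∑ j, |M i j|) * b := by rw [Finset.sum_mul]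
    _ ≤ rowSumNorm M * b :=
        mul_le_mul_of_nonneg_right
          (le_ciSup (f := fun i => ∑ j, |M i j|) (Set.finite_range _).bddAbove i) hb

section recovery

variable (sys : LinSys n m p) {N d : ℕ} {S : Finset (Fin m)} {lam α : ℝ}
  {β : Fin n ⊕ (Fin (N + 1) × S) → ℝ} {w y : Fin (N + 1) × Fin p → ℝ}
  {x : Fin n → ℝ} {u : Fin m → Fin (N + 1) → ℝ}

/-- The correlation of the residual of a restricted minimizer with all columns of `Ψ_S`. -/
theorem LinSys.l2norm_Psi_transpose_residual_le (hT : 0 < numMeas N p) (hlam : 0 ≤ lam)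
    (h : IsRestrictedMin (numMeas N p) lam (sys.obs (N + 1)) (sys.impulse (N + 1)) y S x u) :
    l2norm ((sys.Psi (N + 1) S)ᵀ *ᵥ
      residual (sys.obs (N + 1)) (sys.impulse (N + 1)) y x u) ≤
      √S.card * (numMeas N p * lam) := by
  refine le_of_sq_le_sq ?_ (by positivity)
  rw [mul_pow, Real.sq_sqrt (by positivity), l2norm_sq, sys.Psi_transpose_mulVec,
    h.transpose_mulVec_residual_eq_zero hT hlam]
  simp only [dotProduct, Fintype.sum_sum_type, Sum.elim_inl, Sum.elim_inr, Pi.zero_apply,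
    mul_zero, Finset.sum_const_zero, zero_add, Fintype.sum_prod_type_right]
  calc _ ≤ ∑ _j : S, (numMeas N p * lam) ^ 2 := Finset.sum_le_sum fun j _ => by
        have h1 := h.l2norm_block_le hT hlam j.2
        have h2 := l2norm_sq ((sys.impulse (N + 1) j)ᵀ *ᵥ
          residual (sys.obs (N + 1)) (sys.impulse (N + 1)) y x u)
        rw [dotProduct] at h2
        rw [← h2]
        exact pow_le_pow_left₀ (l2norm_nonneg _) h1 2
    _ = _ := by simp

/-- Strict dual feasibility outside `S`: mutual incoherence bounds the part of the correlation
that comes from the shrinkage of the restricted minimizer, and `hnoise` the part that comes from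
the noise. -/
theorem LinSys.dual_feasible (hT : 0 < numMeas N p) (hlam : 0 ≤ lam)
    (hS : 0 < S.card) (hα : 0 ≤ α) (hA3 : sys.MutualIncoherence N S α)
    (hy : y = sys.Psi (N + 1) S *ᵥ β + w)
    (hnoise : ∀ j ∉ S, l2norm ((sys.impulse (N + 1) j)ᵀ *ᵥ
      ((1 - sys.Psi (N + 1) S * pinv (sys.Psi (N + 1) S)) *ᵥ w)) <
        (1 - α) * (numMeas N p * lam))
    (h : IsRestrictedMin (numMeas N p) lam (sys.obs (N + 1)) (sys.impulse (N + 1)) y S x u)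
    (j : Fin m) (hj : j ∉ S) :
    l2norm ((sys.impulse (N + 1) j)ᵀ *ᵥ
      residual (sys.obs (N + 1)) (sys.impulse (N + 1)) y x u) < numMeas N p * lam := by
  set ρ := residual (sys.obs (N + 1)) (sys.impulse (N + 1)) y x u with hρ
  set Ψ := sys.Psi (N + 1) S with hΨ
  set Jt := (sys.impulse (N + 1) j)ᵀ with hJt
  have h1 : (1 - Ψ * pinv Ψ) *ᵥ ρ = (1 - Ψ * pinv Ψ) *ᵥ w := by
    have h0 := one_sub_pinv_mul Ψ
    rw [hρ, sys.residual_eq N y x h.1, hy, ← hΨ, mulVec_sub, mulVec_add, mulVec_mulVec,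
      mulVec_mulVec, h0, zero_mulVec, zero_mulVec, zero_add, sub_zero]
  have h2 : Jt *ᵥ ρ = (Jt * Ψ * pinv (Ψᵀ * Ψ)) *ᵥ (Ψᵀ *ᵥ ρ) +
      Jt *ᵥ ((1 - Ψ * pinv Ψ) *ᵥ w) := by
    rw [← h1, mulVec_mulVec, Matrix.mul_assoc, ← pinv_eq_pinv_gram_mul, mulVec_mulVec,
      ← add_mulVec, Matrix.mul_assoc, ← Matrix.mul_add, add_sub_cancel, Matrix.mul_one]
  have hcard : (1 : ℝ) ≤ S.card := by exact_mod_cast hS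
  have h3 : l2norm ((Jt * Ψ * pinv (Ψᵀ * Ψ)) *ᵥ (Ψᵀ *ᵥ ρ)) ≤ α * (numMeas N p * lam) := by
    calc _ ≤ α / S.card * (√S.card * (numMeas N p * lam)) :=
          (l2norm_mulVec_le _ _).trans (mul_le_mul (hA3 j hj)
            (sys.l2norm_Psi_transpose_residual_le hT hlam h) (l2norm_nonneg _) (by positivity))
      _ ≤ α / S.card * (S.card * (numMeas N p * lam)) := by
          gcongr
          exact Real.sqrt_le_iff.2 ⟨by positivity, by nlinarith⟩
      _ = α * (numMeas N p * lam) := by field_simp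
  rw [h2]
  linarith [l2norm_add_le ((Jt * Ψ * pinv (Ψᵀ * Ψ)) *ᵥ (Ψᵀ *ᵥ ρ))
    (Jt *ᵥ ((1 - Ψ * pinv Ψ) *ᵥ w)), hnoise j hj]

/-- The error of a restricted minimizer in the delayed inputs: noise plus shrinkage. -/
theorem LinSys.abs_delayed_error_le (hd : sys.inputDelay S = d)
    (hN : max (sys.inputDelay S) (sys.stateDelay S) ≤ N)
    (hT : 0 < numMeas N p) (hlam : 0 ≤ lam)
    (hy : y = sys.Psi (N + 1) S *ᵥ β + w)
    (h : IsRestrictedMin (numMeas N p) lam (sys.obs (N + 1)) (sys.impulse (N + 1)) y S x u)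
    (k : EarlyTime N d) (j : S) :
    |β (Sum.inr (k.val, j)) - u j k.val| ≤
      |(pinv (sys.Psi (N + 1) S) *ᵥ w) (Sum.inr (k.val, j))| +
        lam * rowSumNorm (sys.delayedGramPinv N d S) := by
  set ρ := residual (sys.obs (N + 1)) (sys.impulse (N + 1)) y x u with hρ
  set Ψ := sys.Psi (N + 1) S with hΨ
  set b : Fin n ⊕ (Fin (N + 1) × S) → ℝ := Sum.elim x fun lj => u lj.2 lj.1 with hb
  set T := numMeas N p with hTdef
  have hρ' : ρ = Ψ *ᵥ (β - b) + w := by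
    rw [hρ, sys.residual_eq N y x h.1, hy, mulVec_sub]
    abel
  -- `Ψ⁺ Ψ` fixes the delayed coordinates
  have hfix : (pinv Ψ *ᵥ (Ψ *ᵥ (β - b))) (Sum.inr (k.val, j)) = (β - b) (Sum.inr (k.val, j)) :=
    congrFun (sys.pinv_mulVec_mulVec_comp_earlyIndex hd hN (β - b)) (Sum.inr (k, j))
  have hshrink : (pinv Ψ *ᵥ ρ) (Sum.inr (k.val, j)) =
      T⁻¹ * (sys.delayedGramPinv N d S *ᵥ (Ψᵀ *ᵥ ρ)) (k, j) := by
    have e1 : pinv Ψ *ᵥ ρ = T⁻¹ • (pinv (T⁻¹ • (Ψᵀ * Ψ)) *ᵥ (Ψᵀ *ᵥ ρ)) := by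
      rw [pinv_smul _ (inv_ne_zero hT.ne'), inv_inv, smul_mulVec, smul_smul,
        inv_mul_cancel₀ hT.ne', one_smul, mulVec_mulVec, ← pinv_eq_pinv_gram_mul]
    rw [e1]
    rfl
  have hbound : ∀ c, |(Ψᵀ *ᵥ ρ) c| ≤ T * lam := by
    intro c
    rw [hΨ, sys.Psi_transpose_mulVec]
    rcases c with i | ⟨l, i⟩
    · rw [Sum.elim_inl, hρ, h.transpose_mulVec_residual_eq_zero hT hlam]
      simpa using mul_nonneg hT.le hlam
    · exact (abs_apply_le_l2norm ((sys.impulse (N + 1) i)ᵀ *ᵥ ρ) l).trans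
        (h.l2norm_block_le hT hlam i.2)
  have h1 : |(pinv Ψ *ᵥ ρ) (Sum.inr (k.val, j))| ≤
      lam * rowSumNorm (sys.delayedGramPinv N d S) := by
    rw [hshrink, abs_mul, abs_of_pos (inv_pos.2 hT)]
    calc _ ≤ T⁻¹ * (rowSumNorm (sys.delayedGramPinv N d S) * (T * lam)) := by
          gcongr
          exact abs_mulVec_le_rowSumNorm _ hbound _
      _ = _ := by field_simp
  have h2 : (pinv Ψ *ᵥ ρ) (Sum.inr (k.val, j)) =
      (β (Sum.inr (k.val, j)) - u j k.val) + (pinv Ψ *ᵥ w) (Sum.inr (k.val, j)) := by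
    rw [hρ', mulVec_add, Pi.add_apply, hfix]
    rfl
  have h3 : β (Sum.inr (k.val, j)) - u j k.val =
      -(pinv Ψ *ᵥ w) (Sum.inr (k.val, j)) + (pinv Ψ *ᵥ ρ) (Sum.inr (k.val, j)) := by
    rw [h2]; ring
  rw [h3]
  refine (abs_add_le _ _).trans ?_
  rw [abs_neg]
  linarith

/-- Support recovery for a fixed noise vector `w`. -/
theorem LinSys.support_recovery (hd : sys.inputDelay S = d)
    (hN : max (sys.inputDelay S) (sys.stateDelay S) ≤ N)
    (hT : 0 < numMeas N p) (hlam : 0 < lam)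
    (hS : 0 < S.card) (hα : 0 ≤ α) (hA3 : sys.MutualIncoherence N S α)
    (hy : y = sys.Psi (N + 1) S *ᵥ β + w)
    (hnoise : ∀ j ∉ S, l2norm ((sys.impulse (N + 1) j)ᵀ *ᵥ
      ((1 - sys.Psi (N + 1) S * pinv (sys.Psi (N + 1) S)) *ᵥ w)) <
        (1 - α) * (numMeas N p * lam))
    (hlarge : ∀ j : S, ∃ k : EarlyTime N d,
      |(pinv (sys.Psi (N + 1) S) *ᵥ w) (Sum.inr (k.val, j))| +
        lam * rowSumNorm (sys.delayedGramPinv N d S) < |β (Sum.inr (k.val, j))|) :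
    (∃ xh uh, sys.IsGroupLasso N lam y xh uh) ∧
      ∀ xh uh, sys.IsGroupLasso N lam y xh uh → supportSet uh = S := by
  have hO : ∀ x, sys.obs (N + 1) *ᵥ x = 0 → x = 0 := by
    intro x hx
    have h0 : sys.Psi (N + 1) S *ᵥ Sum.elim x 0 = 0 := by
      rw [LinSys.Psi, fromCols_mulVec, Sum.elim_comp_inl, Sum.elim_comp_inr, hx, mulVec_zero,
        add_zero]
    have := sys.comp_earlyIndex_eq_zero hd hN _ h0
    ext i
    exact congrFun this (Sum.inl i)
  -- the primal-dual witness
  obtain ⟨x, u, h⟩ := exists_isRestrictedMin (J := sys.impulse (N + 1)) (y := y) hT hlam hO S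
  obtain ⟨hglob, hsupp⟩ := h.global hT hlam.le
    (sys.dual_feasible hT hlam.le hS hα hA3 hy hnoise h)
  refine ⟨⟨x, u, hglob⟩, fun xh uh hmin => ?_⟩
  have hout := hsupp xh uh hmin
  have hres : IsRestrictedMin (numMeas N p) lam (sys.obs (N + 1)) (sys.impulse (N + 1)) y S xh uh :=
    ⟨hout, fun x' u' _ => hmin x' u'⟩
  ext j
  simp only [supportSet, Finset.mem_filter, Finset.mem_univ, true_and]
  refine ⟨fun hj => by_contra fun hjS => hj (hout j hjS), fun hjS h0 => ?_⟩
  obtain ⟨k, hk⟩ := hlarge ⟨j, hjS⟩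
  have := sys.abs_delayed_error_le hd hN hT hlam.le hy hres k ⟨j, hjS⟩
  rw [h0, Pi.zero_apply, sub_zero] at this
  linarith

end recovery

/-! ### Tail bounds for sub-Gaussian vectors -/

section tails

/-- A random vector all of whose one-dimensional marginals `⟨h, X⟩` are sub-Gaussian with variance
proxy `(τ ‖h‖₂)²`. -/
def IsSubgaussianVector {Ω κ : Type*} [MeasurableSpace Ω] [Fintype κ] (X : Ω → κ → ℝ) (τ : ℝ)
    (P : Measure Ω) : Prop :=
  ∀ h : κ → ℝ, HasSubgaussianMGF (fun ω => h ⬝ᵥ X ω) (Real.toNNReal ((τ * l2norm h) ^ 2)) P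

variable {Ω : Type*} [MeasurableSpace Ω] {P : Measure Ω}

theorem hasSubgaussianMGF_of_hasLaw_gaussianReal {X : Ω → ℝ} {c : NNReal}
    (hX : HasLaw X (gaussianReal 0 c) P) : HasSubgaussianMGF X c P := by
  have h : HasSubgaussianMGF (id : ℝ → ℝ) c (gaussianReal 0 c) :=
    ⟨fun t => integrable_exp_mul_gaussianReal t, fun t => by simp [mgf_id_gaussianReal]⟩
  exact h.congr_identDistrib
    ⟨aemeasurable_id, hX.aemeasurable, by rw [Measure.map_id, hX.map_eq]⟩

theorem isSubgaussianVector_of_iIndepFun_gaussian {ι : Type*} [Fintype ι]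
    {v : ι → Ω → ℝ} {σ : ℝ} (hindep : iIndepFun v P)
    (hlaw : ∀ i, HasLaw (v i) (gaussianReal 0 (Real.toNNReal (σ ^ 2))) P) :
    IsSubgaussianVector (fun ω i => v i ω) σ P := by
  intro h
  have h1 : iIndepFun (fun i ω => h i * v i ω) P :=
    hindep.comp (fun i x => h i * x) fun i => measurable_const_mul _
  have h2 : ∀ i ∈ Finset.univ, HasSubgaussianMGF (fun ω => h i * v i ω)
      (Real.toNNReal ((h i * σ) ^ 2)) P := by
    intro i _
    apply hasSubgaussianMGF_of_hasLaw_gaussianReal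
    convert gaussianReal_const_mul (hlaw i) (h i) using 2
    · simp
    · ext
      simp [mul_pow, Real.toNNReal_of_nonneg, sq_nonneg, mul_nonneg]
  have h3 := HasSubgaussianMGF.sum_of_iIndepFun h1 h2
  convert h3 using 1
  · rfl
  rw [← Real.toNNReal_sum_of_nonneg fun i _ => sq_nonneg _]
  congr 1
  rw [mul_pow, l2norm_sq, dotProduct, Finset.mul_sum]
  exact Finset.sum_congr rfl fun i _ => by ring

theorem IsSubgaussianVector.mulVec {ι κ : Type*} [Fintype ι] [Fintype κ] {X : Ω → ι → ℝ}
    {σ ρ : ℝ} (hX : IsSubgaussianVector X σ P) (R : Matrix κ ι ℝ)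
    (hR : ∀ h, l2norm (Rᵀ *ᵥ h) ≤ ρ * l2norm h) :
    IsSubgaussianVector (fun ω => R *ᵥ X ω) (σ * ρ) P := by
  intro h
  obtain ⟨h1, h2⟩ := hX (Rᵀ *ᵥ h)
  have e : ∀ ω, h ⬝ᵥ R *ᵥ X ω = (Rᵀ *ᵥ h) ⬝ᵥ X ω := fun ω => by
    rw [dotProduct_mulVec, mulVec_transpose]
  simp only [e]
  refine ⟨h1, fun t => (h2 t).trans ?_⟩
  rw [Real.coe_toNNReal _ (sq_nonneg _), Real.coe_toNNReal _ (sq_nonneg _), mul_pow, mul_assoc σ,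
    mul_pow]
  have := pow_le_pow_left₀ (l2norm_nonneg _) (hR h) 2
  gcongr

/-- `E exp (t ⟨h, x⟩) = exp (t² ‖x‖² / 2)` for a standard Gaussian vector `h`. -/
theorem lintegral_exp_dotProduct_pi_gaussianReal {κ : Type*} [Fintype κ] (t : ℝ) (x : κ → ℝ) :
    ∫⁻ h, ENNReal.ofReal (Real.exp (t * (h ⬝ᵥ x))) ∂Measure.pi (fun _ : κ => gaussianReal 0 1) =
      ENNReal.ofReal (Real.exp (t ^ 2 * l2norm x ^ 2 / 2)) := by
  have e : ∀ h : κ → ℝ, Real.exp (t * (h ⬝ᵥ x)) = ∏ i, Real.exp ((t * x i) * h i) := by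
    intro h
    rw [← Real.exp_sum, dotProduct, Finset.mul_sum]
    congr 1
    exact Finset.sum_congr rfl fun i _ => by ring
  simp only [e]
  rw [← ofReal_integral_eq_lintegral_ofReal
    (Integrable.fintype_prod fun i => integrable_exp_mul_gaussianReal (t * x i))
    (ae_of_all _ fun h => Finset.prod_nonneg fun i _ => (Real.exp_pos _).le)]
  congr 1
  rw [integral_fintype_prod_eq_prod fun (i : κ) (a : ℝ) => Real.exp ((t * x i) * a)]
  have h1 : ∀ s : ℝ, ∫ a, Real.exp (s * a) ∂gaussianReal 0 1 = Real.exp (s ^ 2 / 2) := by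
    intro s
    have := congrFun (mgf_id_gaussianReal (μ := 0) (v := 1)) s
    simpa [mgf] using this
  simp only [h1]
  rw [← Real.exp_sum, l2norm_sq, dotProduct, Finset.mul_sum, Finset.sum_div]
  congr 1
  exact Finset.sum_congr rfl fun i _ => by ring

/-- Tilting the standard Gaussian density by `exp (x² / 4)` gives `√2` times the Gaussian density
of variance `2`. -/
theorem gaussianPDFReal_mul_exp_sq (x : ℝ) :
    gaussianPDFReal 0 1 x * Real.exp (x ^ 2 / 4) = √2 * gaussianPDFReal 0 2 x := by
  simp only [gaussianPDFReal, NNReal.coe_one, mul_one, sub_zero, NNReal.coe_ofNat]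
  rw [mul_assoc, ← Real.exp_add, Real.sqrt_mul (by positivity) 2, mul_inv]
  have h2 : √2 ≠ 0 := by positivity
  have e : -x ^ 2 / 2 + x ^ 2 / 4 = -x ^ 2 / (2 * 2) := by ring
  rw [e]
  field_simp

theorem lintegral_exp_sq_gaussianReal :
    ∫⁻ x, ENNReal.ofReal (Real.exp (x ^ 2 / 4)) ∂gaussianReal 0 1 = ENNReal.ofReal √2 := by
  rw [gaussianReal_of_var_ne_zero 0 one_ne_zero, lintegral_withDensity_eq_lintegral_mul _
    (measurable_gaussianPDF 0 1) (by fun_prop)]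
  have e : ∀ x, (gaussianPDF 0 1 * fun x => ENNReal.ofReal (Real.exp (x ^ 2 / 4))) x =
      ENNReal.ofReal √2 * gaussianPDF 0 2 x := by
    intro x
    rw [Pi.mul_apply, gaussianPDF, gaussianPDF, ← ENNReal.ofReal_mul (gaussianPDFReal_nonneg _ _ _),
      ← ENNReal.ofReal_mul (by positivity), gaussianPDFReal_mul_exp_sq]
  simp only [e]
  rw [lintegral_const_mul _ (measurable_gaussianPDF 0 2),
    lintegral_gaussianPDF_eq_one 0 two_ne_zero, mul_one]

theorem lintegral_exp_l2norm_sq_pi_gaussianReal (κ : Type*) [Fintype κ] :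
    ∫⁻ h, ENNReal.ofReal (Real.exp (l2norm h ^ 2 / 4))
      ∂Measure.pi (fun _ : κ => gaussianReal 0 1) = ENNReal.ofReal (√2 ^ Fintype.card κ) := by
  have hint : Integrable (fun x : ℝ => Real.exp (x ^ 2 / 4)) (gaussianReal 0 1) := by
    refine ⟨by fun_prop, ?_⟩
    rw [hasFiniteIntegral_iff_ofReal (ae_of_all _ fun x => (Real.exp_pos _).le),
      lintegral_exp_sq_gaussianReal]
    exact ENNReal.ofReal_lt_top
  have e : ∀ h : κ → ℝ, Real.exp (l2norm h ^ 2 / 4) = ∏ i, Real.exp (h i ^ 2 / 4) := by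
    intro h
    rw [← Real.exp_sum, l2norm_sq, dotProduct, Finset.sum_div]
    congr 1
    exact Finset.sum_congr rfl fun i _ => by ring
  simp only [e]
  rw [← ofReal_integral_eq_lintegral_ofReal (Integrable.fintype_prod fun _ => hint)
    (ae_of_all _ fun h => Finset.prod_nonneg fun i _ => (Real.exp_pos _).le)]
  congr 1
  rw [integral_fintype_prod_eq_prod fun (_ : κ) (a : ℝ) => Real.exp (a ^ 2 / 4),
    Finset.prod_const, Finset.card_univ]
  congr 1
  rw [integral_eq_lintegral_of_nonneg_ae (ae_of_all _ fun x => (Real.exp_pos _).le)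
    (by fun_prop), lintegral_exp_sq_gaussianReal, ENNReal.toReal_ofReal (by positivity)]

variable [IsProbabilityMeasure P]

/-- The exponential moment of the squared norm of a sub-Gaussian vector. Decoupling with an
independent standard Gaussian vector `h` writes `exp (‖X‖² / (4 τ²))` as an average of
`exp (⟨h, X⟩ / (√2 τ))`, whose expectation is at most `exp (‖h‖² / 4)`. -/
theorem IsSubgaussianVector.lintegral_exp_l2norm_sq_le {κ : Type*} [Fintype κ] {X : Ω → κ → ℝ}
    {τ : ℝ} (hτ : 0 < τ) (hX : IsSubgaussianVector X τ P)
    (hm : ∀ k, AEMeasurable (fun ω => X ω k) P) :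
    ∫⁻ ω, ENNReal.ofReal (Real.exp (l2norm (X ω) ^ 2 / (4 * τ ^ 2))) ∂P ≤
      ENNReal.ofReal (√2 ^ Fintype.card κ) := by
  set b := (√2 * τ)⁻¹ with hb
  have hb2 : b ^ 2 = 1 / (2 * τ ^ 2) := by
    rw [hb, inv_pow, mul_pow, Real.sq_sqrt (by norm_num), one_div]
  calc ∫⁻ ω, ENNReal.ofReal (Real.exp (l2norm (X ω) ^ 2 / (4 * τ ^ 2))) ∂P
      = ∫⁻ ω, ∫⁻ h, ENNReal.ofReal (Real.exp (b * (h ⬝ᵥ X ω)))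
          ∂Measure.pi (fun _ : κ => gaussianReal 0 1) ∂P := by
        refine lintegral_congr fun ω => ?_
        rw [lintegral_exp_dotProduct_pi_gaussianReal, hb2]
        congr 2
        field_simp
        norm_num
    _ = ∫⁻ h, ∫⁻ ω, ENNReal.ofReal (Real.exp (b * (h ⬝ᵥ X ω))) ∂P
          ∂Measure.pi (fun _ : κ => gaussianReal 0 1) := by
        refine lintegral_lintegral_swap ?_
        have : AEMeasurable (fun q : Ω × (κ → ℝ) => q.2 ⬝ᵥ X q.1)
            (P.prod (Measure.pi fun _ : κ => gaussianReal 0 1)) := by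
          simp only [dotProduct]
          refine Finset.aemeasurable_fun_sum _ fun k _ => ?_
          exact AEMeasurable.mul (by fun_prop) (hm k).comp_fst
        exact (Real.measurable_exp.comp_aemeasurable (this.const_mul b)).ennreal_ofReal
    _ ≤ ∫⁻ h, ENNReal.ofReal (Real.exp (l2norm h ^ 2 / 4))
          ∂Measure.pi (fun _ : κ => gaussianReal 0 1) := by
        refine lintegral_mono fun h => ?_
        obtain ⟨h1, h2⟩ := hX h
        rw [← ofReal_integral_eq_lintegral_ofReal (h1 b) (ae_of_all _ fun _ => (Real.exp_pos _).le)]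
        refine ENNReal.ofReal_le_ofReal ((h2 b).trans (le_of_eq ?_))
        rw [Real.coe_toNNReal _ (sq_nonneg _), hb2]
        congr 1
        field_simp
        norm_num
    _ = _ := lintegral_exp_l2norm_sq_pi_gaussianReal κ

theorem IsSubgaussianVector.measureReal_le_l2norm_le {κ : Type*} [Fintype κ] {X : Ω → κ → ℝ}
    {τ : ℝ} (hτ : 0 < τ) (hX : IsSubgaussianVector X τ P)
    (hm : ∀ k, AEMeasurable (fun ω => X ω k) P) {t : ℝ} (ht : 0 ≤ t) :
    P.real {ω | t ≤ l2norm (X ω)} ≤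
      √2 ^ Fintype.card κ * Real.exp (-(t ^ 2 / (4 * τ ^ 2))) := by
  have hmeas : AEMeasurable
      (fun ω => ENNReal.ofReal (Real.exp (l2norm (X ω) ^ 2 / (4 * τ ^ 2)))) P := by
    have h1 : AEMeasurable X P := aemeasurable_pi_lambda _ hm
    have h2 : AEMeasurable (fun ω => l2norm (X ω)) P :=
      continuous_l2norm.measurable.comp_aemeasurable h1
    fun_prop
  have h1 := (mul_meas_ge_le_lintegral₀ hmeas
    (ENNReal.ofReal (Real.exp (t ^ 2 / (4 * τ ^ 2))))).trans
      (hX.lintegral_exp_l2norm_sq_le hτ hm)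
  have h2 : {ω | t ≤ l2norm (X ω)} ⊆ {ω | ENNReal.ofReal (Real.exp (t ^ 2 / (4 * τ ^ 2))) ≤
      ENNReal.ofReal (Real.exp (l2norm (X ω) ^ 2 / (4 * τ ^ 2)))} := by
    intro ω hω
    have : t ≤ l2norm (X ω) := hω
    refine ENNReal.ofReal_le_ofReal (Real.exp_le_exp.2 ?_)
    gcongr
  have h3 := ENNReal.toReal_mono ENNReal.ofReal_ne_top
    ((mul_le_mul_right (measure_mono h2) _).trans h1)
  rw [ENNReal.toReal_mul, ENNReal.toReal_ofReal (Real.exp_pos _).le,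
    ENNReal.toReal_ofReal (by positivity)] at h3
  rw [Real.exp_neg, ← div_eq_mul_inv, le_div_iff₀ (Real.exp_pos _), mul_comm]
  exact h3

theorem IsSubgaussianVector.measureReal_le_abs_apply_le {κ : Type*} [Fintype κ]
    {X : Ω → κ → ℝ} {τ : ℝ} (hX : IsSubgaussianVector X τ P) (k : κ) {t : ℝ} (ht : 0 ≤ t) :
    P.real {ω | t ≤ |X ω k|} ≤ 2 * Real.exp (-(t ^ 2 / (2 * τ ^ 2))) := by
  classical
  have hk := hX (Pi.single k 1)
  have h1 : l2norm (Pi.single k 1 : κ → ℝ) ^ 2 = 1 := by simp [l2norm_sq]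
  simp only [single_dotProduct, one_mul, mul_pow, h1, mul_one] at hk
  have hpos := hk.measure_ge_le ht
  have hneg := hk.neg.measure_ge_le ht
  rw [Real.coe_toNNReal _ (sq_nonneg _), neg_div] at hpos hneg
  have hsub : {ω | t ≤ |X ω k|} ⊆ {ω | t ≤ X ω k} ∪ {ω | t ≤ (-fun ω => X ω k) ω} := by
    intro ω hω
    have : t ≤ |X ω k| := hω
    exact le_abs.1 this
  linarith [(measureReal_mono hsub).trans (measureReal_union_le (μ := P) _ _)]

end tails

/-! ### The delayed least-squares estimator -/

/-- The linear map from the measurements to the delayed least-squares estimate, in the form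
`G⁻¹ Ψ_{S,[N:d]}ᵀ M` with `G = Ψ_{S,[N:d]}ᵀ M Ψ_{S,[N:d]}`. -/
noncomputable def LinSys.earlyEstimator (sys : LinSys n m p) (N d : ℕ) (S : Finset (Fin m)) :
    Matrix (Fin n ⊕ (EarlyTime N d × S)) (Fin (N + 1) × Fin p) ℝ :=
  pinv ((sys.PsiEarly N d S)ᵀ * sys.lateProj N d S * sys.PsiEarly N d S) *
    ((sys.PsiEarly N d S)ᵀ * sys.lateProj N d S)

section estimator

variable (sys : LinSys n m p) {N d : ℕ} {S : Finset (Fin m)}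

theorem LinSys.pinv_mulVec_comp_earlyIndex (hd : sys.inputDelay S = d)
    (hN : max (sys.inputDelay S) (sys.stateDelay S) ≤ N) (w : Fin (N + 1) × Fin p → ℝ) :
    (pinv (sys.Psi (N + 1) S) *ᵥ w) ∘ earlyIndex N d S = sys.earlyEstimator N d S *ᵥ w :=
  pinv_mulVec_comp_eq (bijective_earlyIndex_lateIndex N d S)
    (sys.comp_earlyIndex_eq_zero hd hN) rfl w

theorem LinSys.l2norm_earlyEstimator_transpose_mulVec_le (hd : sys.inputDelay S = d)
    (hN : max (sys.inputDelay S) (sys.stateDelay S) ≤ N) (hT : 0 < numMeas N p) {cmin : ℝ}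
    (hcmin : 0 < cmin) (hA2 : sys.LeastSingularValue N d S cmin)
    (h : Fin n ⊕ (EarlyTime N d × S) → ℝ) :
    l2norm ((sys.earlyEstimator N d S)ᵀ *ᵥ h) ≤ (√(numMeas N p * cmin))⁻¹ * l2norm h := by
  refine le_of_sq_le_sq ?_ (mul_nonneg (by positivity) (l2norm_nonneg _))
  have h1 : l2norm ((sys.earlyEstimator N d S)ᵀ *ᵥ h) ^ 2 =
      h ⬝ᵥ pinv ((sys.PsiEarly N d S)ᵀ * sys.lateProj N d S * sys.PsiEarly N d S) *ᵥ h :=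
    l2norm_partialOut_transpose_mulVec_sq (bijective_earlyIndex_lateIndex N d S)
      (sys.comp_earlyIndex_eq_zero hd hN) rfl h
  set G := (sys.PsiEarly N d S)ᵀ * sys.lateProj N d S * sys.PsiEarly N d S with hG
  set T := numMeas N p with hTdef
  have h2 : pinv G *ᵥ h = T⁻¹ • (pinv (T⁻¹ • G) *ᵥ h) := by
    rw [pinv_smul _ (inv_ne_zero hT.ne'), inv_inv, smul_mulVec, smul_smul,
      inv_mul_cancel₀ hT.ne', one_smul]
  have h3 : h ⬝ᵥ (pinv (T⁻¹ • G) *ᵥ h) ≤ l2norm h * (1 / cmin * l2norm h) :=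
    (dotProduct_le_l2norm _ _).trans (mul_le_mul_of_nonneg_left
      ((l2norm_mulVec_le _ _).trans (mul_le_mul_of_nonneg_right hA2 (l2norm_nonneg _)))
      (l2norm_nonneg _))
  rw [h1, h2, dotProduct_smul, smul_eq_mul, mul_pow, inv_pow, Real.sq_sqrt (by positivity)]
  calc T⁻¹ * (h ⬝ᵥ (pinv (T⁻¹ • G) *ᵥ h)) ≤ T⁻¹ * (l2norm h * (1 / cmin * l2norm h)) := by gcongr
    _ = _ := by field_simp

/-- Refit on the true support, the delayed least-squares estimate errs by the filtered noise. -/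
theorem LinSys.l2norm_delayedTruth_sub_delayedOLS {x0 : Fin n → ℝ} {u : ℕ → Fin m → ℝ}
    (hS : S = activeSet N u) (hd : sys.inputDelay S = d)
    (hN : max (sys.inputDelay S) (sys.stateDelay S) ≤ N) (v : Fin (N + 1) × Fin p → ℝ) :
    l2norm (delayedTruth N d x0 u - sys.delayedOLS N d S (sys.measurement (N + 1) x0 u v)) =
      l2norm (sys.earlyEstimator N d S *ᵥ v) := by
  have hest : (pinv (sys.Psi (N + 1) S) *ᵥ sys.measurement (N + 1) x0 u v) ∘ earlyIndex N d S =
      batchTruth N S x0 u ∘ earlyIndex N d S + sys.earlyEstimator N d S *ᵥ v := by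
    rw [sys.measurement_eq, ← hS, mulVec_add, ← sys.pinv_mulVec_comp_earlyIndex hd hN,
      ← sys.pinv_mulVec_mulVec_comp_earlyIndex hd hN (batchTruth N S x0 u)]
    rfl
  set y := sys.measurement (N + 1) x0 u v
  have hl : ∀ s, (pinv (sys.Psi (N + 1) S) *ᵥ y) (Sum.inl s) =
      x0 s + (sys.earlyEstimator N d S *ᵥ v) (Sum.inl s) := fun s => congrFun hest (Sum.inl s)
  have hr : ∀ (k : EarlyTime N d) (j : S), (pinv (sys.Psi (N + 1) S) *ᵥ y) (Sum.inr (k.val, j)) =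
      u k.val j + (sys.earlyEstimator N d S *ᵥ v) (Sum.inr (k, j)) :=
    fun k j => congrFun hest (Sum.inr (k, j))
  rw [← sq_eq_sq₀ (l2norm_nonneg _) (l2norm_nonneg _), l2norm_sq, l2norm_sq]
  simp only [dotProduct, Fintype.sum_sum_type, Fintype.sum_prod_type]
  congr 1
  · refine Finset.sum_congr rfl fun s _ => ?_
    simp only [Pi.sub_apply, delayedTruth, LinSys.delayedOLS, hl]
    ring
  · refine Finset.sum_congr rfl fun k _ => ?_
    have hout : ∀ j ∉ S, (delayedTruth N d x0 u - sys.delayedOLS N d S y) (Sum.inr (k, j)) = 0 := by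
      intro j hj
      have : u k.val j = 0 :=
        apply_eq_zero_of_notMem_activeSet (hS ▸ hj) (Nat.lt_succ_iff.1 k.val.2)
      simp [delayedTruth, LinSys.delayedOLS, hj, this]
    have hin : ∀ j : S,
        (delayedTruth N d x0 u - sys.delayedOLS N d S y) (Sum.inr (k, (j : Fin m))) =
        -(sys.earlyEstimator N d S *ᵥ v) (Sum.inr (k, j)) := by
      intro j
      simp only [Pi.sub_apply, delayedTruth, LinSys.delayedOLS, j.2, dite_true, hr]
      ring
    rw [← Finset.sum_subset (Finset.subset_univ S) fun j _ hj => by rw [hout j hj, mul_zero],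
      ← Finset.sum_coe_sort S]
    refine Finset.sum_congr rfl fun j _ => ?_
    rw [hin, neg_mul_neg]

theorem card_earlyTime (h : d ≤ N) : Fintype.card (EarlyTime N d) = N - d + 1 := by
  have e : EarlyTime N d ≃ Fin (N - d + 1) :=
    { toFun := fun k => ⟨k.1, by have := k.2; omega⟩
      invFun := fun k => ⟨⟨k, by have := k.2; omega⟩, by have := k.2; simp only; omega⟩
      left_inv := fun _ => rfl
      right_inv := fun _ => rfl }
  rw [Fintype.card_congr e, Fintype.card_fin]

theorem card_earlyTime_prod (h : d ≤ N) :
    (Fintype.card (EarlyTime N d × S) : ℝ) = numDelayed N d S := by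
  rw [Fintype.card_prod, card_earlyTime h, Fintype.card_coe, numDelayed]
  push_cast [Nat.cast_sub h]
  ring

/-- A system without sensors has infinite input delay. -/
theorem LinSys.numMeas_pos (hS : 0 < S.card) (hd : sys.inputDelay S = d) : 0 < numMeas N p := by
  have hp : 0 < p := by
    rcases Nat.eq_zero_or_pos p with rfl | h
    · have := sys.input_zero_of_forced_eq_zero hd (fun _ _ => 1) fun _ _ i => i.elim0
      obtain ⟨j, hj⟩ := Finset.card_pos.1 hS
      exact absurd (congrFun this ⟨j, hj⟩) one_ne_zero
    · exact h
  have : (0 : ℝ) < p := by exact_mod_cast hp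
  unfold numMeas
  positivity

theorem LinSys.delay_le (hd : sys.inputDelay S = d)
    (hN : max (sys.inputDelay S) (sys.stateDelay S) ≤ N) : d ≤ N := by
  have := (le_max_left _ _).trans hN
  rw [hd] at this
  exact_mod_cast this

open scoped Matrix.Norms.L2Operator in
/-- The normalization constant is positive, since some impulse response is not zero. -/
theorem LinSys.GroupNormalized.pos {K : ℝ} (hA1 : sys.GroupNormalized N K) (hS : 0 < S.card)
    (hd : sys.inputDelay S = d) (hN : max (sys.inputDelay S) (sys.stateDelay S) ≤ N) : 0 < K := by
  by_contra hK
  push Not at hK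
  have hJ : ∀ j, sys.impulse (N + 1) j = 0 := by
    intro j
    have h1 := (hA1.2 j).trans (mul_nonpos_of_nonpos_of_nonneg hK (Real.sqrt_nonneg _))
    exact norm_le_zero_iff.1 h1
  have hΨ : sys.Psi (N + 1) S *ᵥ Sum.elim 0 1 = 0 := by
    have : sys.impulseSet (N + 1) S = 0 := by
      ext ki lj
      simp [LinSys.impulseSet, hJ]
    rw [LinSys.Psi, fromCols_mulVec, Sum.elim_comp_inl, Sum.elim_comp_inr, this, mulVec_zero,
      zero_mulVec, add_zero]
  obtain ⟨j, hj⟩ := Finset.card_pos.1 hS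
  have := congrFun (sys.comp_earlyIndex_eq_zero hd hN _ hΨ)
    (Sum.inr (⟨0, by simpa using sys.delay_le hd hN⟩, ⟨j, hj⟩))
  exact one_ne_zero (α := ℝ) this

end estimator

/-! ### Probabilities of the bad noise events -/

section events

variable (sys : LinSys n m p) {Ω : Type*} [MeasurableSpace Ω] {P : Measure Ω}
  {N d : ℕ} {S : Finset (Fin m)} {σ K α δ cmin : ℝ}
  {v : Fin (N + 1) × Fin p → Ω → ℝ}

theorem aemeasurable_mulVec {ι κ : Type*} [Fintype ι] {v : ι → Ω → ℝ}
    (hv : ∀ i, AEMeasurable (v i) P) (R : Matrix κ ι ℝ) (k : κ) :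
    AEMeasurable (fun ω => (R *ᵥ fun i => v i ω) k) P := by
  simp only [mulVec, dotProduct]
  exact Finset.aemeasurable_fun_sum _ fun i _ => (hv i).const_mul _

theorem lambdaT_pos (hK : 0 < K) (hσ : 0 < σ) (hα : α < 1) (hδ : 0 < δ) :
    0 < lambdaT N m p S σ K α δ := by
  have : 0 < 1 - α := by linarith
  unfold lambdaT
  positivity

theorem LinSys.isSubgaussianVector_earlyEstimator (hd : sys.inputDelay S = d)
    (hN : max (sys.inputDelay S) (sys.stateDelay S) ≤ N) (hT : 0 < numMeas N p)
    (hcmin : 0 < cmin) (hA2 : sys.LeastSingularValue N d S cmin)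
    (hsub : IsSubgaussianVector (fun ω i => v i ω) σ P) :
    IsSubgaussianVector (fun ω => sys.earlyEstimator N d S *ᵥ fun i => v i ω)
      (σ * (√(numMeas N p * cmin))⁻¹) P :=
  hsub.mulVec _ (sys.l2norm_earlyEstimator_transpose_mulVec_le hd hN hT hcmin hA2)

variable [IsProbabilityMeasure P]

/-- The noise seen by the inactive inputs reaches the slack `(1 - α) T λ_T` with small
probability. -/
theorem LinSys.measureReal_inactive_noise_le (hT : 0 < numMeas N p) (hK : 0 < K) (hσ : 0 < σ)
    (hα : α < 1) (hδ : 0 < δ) (hS_lt : S.card < m) (hA1 : sys.GroupNormalized N K)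
    (hv : ∀ i, AEMeasurable (v i) P) (hsub : IsSubgaussianVector (fun ω i => v i ω) σ P) :
    P.real (⋃ j ∈ Sᶜ, {ω | (1 - α) * (numMeas N p * lambdaT N m p S σ K α δ) ≤
      l2norm (((sys.impulse (N + 1) j)ᵀ *
        (1 - sys.Psi (N + 1) S * pinv (sys.Psi (N + 1) S))) *ᵥ fun i => v i ω)}) ≤
      2 * Real.exp (-(numMeas N p * δ ^ 2 / 2)) := by
  set T := numMeas N p with hTdef
  set L5 := ((N : ℝ) + 1) * Real.log 5 with hL5
  set LM := Real.log ((m : ℝ) - S.card) with hLM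
  set t := (1 - α) * (T * lambdaT N m p S σ K α δ) with ht
  have hM : (1 : ℝ) ≤ (m : ℝ) - S.card := by
    have : ((S.card + 1 : ℕ) : ℝ) ≤ m := by exact_mod_cast hS_lt
    push_cast at this
    linarith
  have hLM0 : 0 ≤ LM := Real.log_nonneg hM
  have hL50 : 0 ≤ L5 := mul_nonneg (by positivity) (Real.log_nonneg (by norm_num))
  have h1α : 0 < 1 - α := by linarith
  have ht_eq : t = √32 * K * σ * T * (√((L5 + LM) / T) + δ / 2) := by
    rw [ht, lambdaT, ← hTdef, ← hL5, ← hLM]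
    field_simp
  have ht0 : 0 ≤ t := by rw [ht_eq]; positivity
  have hexp : 8 * (L5 + LM) + 2 * T * δ ^ 2 ≤ t ^ 2 / (4 * (σ * (K * √T)) ^ 2) := by
    have e : t ^ 2 / (4 * (σ * (K * √T)) ^ 2) = 8 * T * (√((L5 + LM) / T) + δ / 2) ^ 2 := by
      rw [ht_eq]
      simp only [mul_pow]
      rw [Real.sq_sqrt (by norm_num), Real.sq_sqrt hT.le]
      field_simp
      norm_num
    rw [e]
    have h1 : √((L5 + LM) / T) ^ 2 = (L5 + LM) / T := Real.sq_sqrt (by positivity)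
    have h2 : 0 ≤ √((L5 + LM) / T) := Real.sqrt_nonneg _
    have h3 : (L5 + LM) / T + δ ^ 2 / 4 ≤ (√((L5 + LM) / T) + δ / 2) ^ 2 := by
      nlinarith [mul_nonneg h2 hδ.le]
    calc 8 * (L5 + LM) + 2 * T * δ ^ 2 = 8 * T * ((L5 + LM) / T + δ ^ 2 / 4) := by
          field_simp; ring
      _ ≤ _ := by gcongr
  have hpow : √2 ^ (N + 1) ≤ Real.exp L5 := by
    have h5 : Real.exp L5 = 5 ^ (N + 1) := by
      rw [hL5, mul_comm, Real.exp_mul, Real.exp_log (by norm_num)]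
      exact_mod_cast Real.rpow_natCast 5 (N + 1)
    rw [h5]
    exact pow_le_pow_left₀ (by positivity) (Real.sqrt_le_iff.2 ⟨by norm_num, by norm_num⟩) _
  have hone : ∀ j ∈ Sᶜ, P.real {ω | t ≤ l2norm (((sys.impulse (N + 1) j)ᵀ *
      (1 - sys.Psi (N + 1) S * pinv (sys.Psi (N + 1) S))) *ᵥ fun i => v i ω)} ≤
      Real.exp (L5 - (8 * (L5 + LM) + 2 * T * δ ^ 2)) := by
    intro j _
    have hR : ∀ h, l2norm (((sys.impulse (N + 1) j)ᵀ *
        (1 - sys.Psi (N + 1) S * pinv (sys.Psi (N + 1) S)))ᵀ *ᵥ h) ≤ K * √T * l2norm h := by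
      intro h
      rw [transpose_mul, transpose_transpose, one_sub_pinv_transpose, ← mulVec_mulVec]
      exact (l2norm_one_sub_pinv_mulVec_le _ _).trans ((l2norm_mulVec_le _ _).trans
        (mul_le_mul_of_nonneg_right (hA1.2 j) (l2norm_nonneg _)))
    refine ((hsub.mulVec _ hR).measureReal_le_l2norm_le (by positivity)
      (aemeasurable_mulVec hv _) ht0).trans ?_
    rw [Fintype.card_fin, sub_eq_add_neg, Real.exp_add]
    gcongr
  have hMexp : ((Sᶜ : Finset (Fin m)).card : ℝ) = Real.exp LM := by
    rw [hLM, Real.exp_log (by linarith), Finset.card_compl, Fintype.card_fin,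
      Nat.cast_sub hS_lt.le]
  calc _ ≤ ∑ j ∈ Sᶜ, Real.exp (L5 - (8 * (L5 + LM) + 2 * T * δ ^ 2)) :=
        (measureReal_biUnion_finset_le _ _).trans (Finset.sum_le_sum hone)
    _ = Real.exp (LM + (L5 - (8 * (L5 + LM) + 2 * T * δ ^ 2))) := by
        rw [Finset.sum_const, nsmul_eq_mul, hMexp, ← Real.exp_add]
    _ ≤ Real.exp (-(T * δ ^ 2 / 2)) := by
        apply Real.exp_le_exp.2
        have : 0 ≤ T * δ ^ 2 := by positivity
        linarith
    _ ≤ _ := by linarith [Real.exp_pos (-(T * δ ^ 2 / 2))]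

/-- The noise in some delayed input reaches the first term of `β_min` with small probability. -/
theorem LinSys.measureReal_delayed_noise_le (hd : sys.inputDelay S = d)
    (hN : max (sys.inputDelay S) (sys.stateDelay S) ≤ N) (hT : 0 < numMeas N p) (hσ : 0 < σ)
    (hS : 0 < S.card) (hδ : 0 < δ) (hcmin : 0 < cmin) (hA2 : sys.LeastSingularValue N d S cmin)
    (hsub : IsSubgaussianVector (fun ω i => v i ω) σ P) :
    P.real (⋃ c ∈ (Finset.univ : Finset (EarlyTime N d × S)),
      {ω | σ / √cmin * (√(2 * Real.log (numDelayed N d S) / numMeas N p) + δ) ≤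
        |(sys.earlyEstimator N d S *ᵥ fun i => v i ω) (Sum.inr c)|}) ≤
      2 * Real.exp (-(numMeas N p * δ ^ 2 / 2)) := by
  have hcard := card_earlyTime_prod (S := S) (sys.delay_le hd hN)
  set T := numMeas N p with hTdef
  set q := numDelayed N d S with hq
  have hq1 : 1 ≤ q := by
    have h1 : 0 < Fintype.card (EarlyTime N d × S) := by
      rw [Fintype.card_prod, card_earlyTime (sys.delay_le hd hN), Fintype.card_coe]
      positivity
    rw [← hcard]
    exact_mod_cast h1
  have hlog := Real.log_nonneg hq1
  set t := σ / √cmin * (√(2 * Real.log q / T) + δ) with ht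
  have ht0 : 0 ≤ t := by positivity
  have hexp : Real.log q + T * δ ^ 2 / 2 ≤ t ^ 2 / (2 * (σ * (√(T * cmin))⁻¹) ^ 2) := by
    have e : t ^ 2 / (2 * (σ * (√(T * cmin))⁻¹) ^ 2) =
        T / 2 * (√(2 * Real.log q / T) + δ) ^ 2 := by
      rw [ht]
      simp only [mul_pow, div_pow, inv_pow]
      rw [Real.sq_sqrt hcmin.le, Real.sq_sqrt (by positivity : 0 ≤ T * cmin)]
      field_simp
    rw [e]
    have h1 : √(2 * Real.log q / T) ^ 2 = 2 * Real.log q / T := Real.sq_sqrt (by positivity)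
    have h2 : 0 ≤ √(2 * Real.log q / T) := Real.sqrt_nonneg _
    have h3 : 2 * Real.log q / T + δ ^ 2 ≤ (√(2 * Real.log q / T) + δ) ^ 2 := by
      nlinarith [mul_nonneg h2 hδ.le]
    calc Real.log q + T * δ ^ 2 / 2 = T / 2 * (2 * Real.log q / T + δ ^ 2) := by
          field_simp
      _ ≤ _ := by gcongr
  have hone : ∀ c ∈ (Finset.univ : Finset (EarlyTime N d × S)),
      P.real {ω | t ≤ |(sys.earlyEstimator N d S *ᵥ fun i => v i ω) (Sum.inr c)|} ≤
      2 * Real.exp (-(Real.log q + T * δ ^ 2 / 2)) := by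
    intro c _
    refine ((sys.isSubgaussianVector_earlyEstimator hd hN hT hcmin
      hA2 hsub).measureReal_le_abs_apply_le (Sum.inr c) ht0).trans ?_
    gcongr
  refine (measureReal_biUnion_finset_le _ _).trans ((Finset.sum_le_sum hone).trans (le_of_eq ?_))
  rw [Finset.sum_const, nsmul_eq_mul, Finset.card_univ, hcard, neg_add, Real.exp_add, Real.exp_neg,
    Real.exp_log (by linarith)]
  field_simp

/-- The error of the delayed least-squares estimate reaches the stated bound with probability at
most `δ₁`. -/
theorem LinSys.measureReal_ols_error_le (hd : sys.inputDelay S = d)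
    (hN : max (sys.inputDelay S) (sys.stateDelay S) ≤ N) (hT : 0 < numMeas N p) (hσ : 0 < σ)
    (hcmin : 0 < cmin) (hA2 : sys.LeastSingularValue N d S cmin)
    {δ₁ : ℝ} (hδ₁ : 0 < δ₁) (hδ₁_lt : δ₁ < 1)
    (hv : ∀ i, AEMeasurable (v i) P) (hsub : IsSubgaussianVector (fun ω i => v i ω) σ P) :
    P.real {ω | 4 * σ / √cmin * √(((n : ℝ) + numDelayed N d S) / numMeas N p) +
        2 * σ / √cmin * √(1 / numMeas N p * Real.log (1 / δ₁)) ≤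
      l2norm (sys.earlyEstimator N d S *ᵥ fun i => v i ω)} ≤ δ₁ := by
  have hcard : (Fintype.card (Fin n ⊕ (EarlyTime N d × S)) : ℝ) = n + numDelayed N d S := by
    rw [Fintype.card_sum, Nat.cast_add, card_earlyTime_prod (sys.delay_le hd hN), Fintype.card_fin]
  set T := numMeas N p with hTdef
  set q := (n : ℝ) + numDelayed N d S with hq
  have hq0 : 0 ≤ q := by rw [← hcard]; positivity
  set L := Real.log (1 / δ₁) with hL
  have hL0 : 0 ≤ L := Real.log_nonneg (by rw [le_div_iff₀ hδ₁]; linarith)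
  set t := 4 * σ / √cmin * √(q / T) + 2 * σ / √cmin * √(1 / T * L) with ht
  have ht0 : 0 ≤ t := by positivity
  have hexp : q + L ≤ t ^ 2 / (4 * (σ * (√(T * cmin))⁻¹) ^ 2) := by
    have e0 : t = σ * (√(T * cmin))⁻¹ * (4 * √q + 2 * √L) := by
      rw [ht, Real.sqrt_div hq0, Real.sqrt_mul (by positivity), Real.sqrt_mul hT.le,
        Real.sqrt_div zero_le_one, Real.sqrt_one]
      field_simp
    have e : t ^ 2 / (4 * (σ * (√(T * cmin))⁻¹) ^ 2) = (4 * √q + 2 * √L) ^ 2 / 4 := by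
      have hne : σ * (√(T * cmin))⁻¹ ≠ 0 := by positivity
      rw [e0, mul_pow]
      field_simp
    rw [e]
    have h1 := Real.sq_sqrt hq0
    have h2 := Real.sq_sqrt hL0
    nlinarith [mul_nonneg (Real.sqrt_nonneg q) (Real.sqrt_nonneg L)]
  refine ((sys.isSubgaussianVector_earlyEstimator hd hN hT hcmin
    hA2 hsub).measureReal_le_l2norm_le (by positivity) (aemeasurable_mulVec hv _) ht0).trans ?_
  have hpow : √2 ^ Fintype.card (Fin n ⊕ (EarlyTime N d × S)) ≤ Real.exp q := by
    rw [← hcard, ← mul_one (Fintype.card _ : ℝ), Real.exp_nat_mul]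
    refine pow_le_pow_left₀ (by positivity) ?_ _
    have h1 : √2 ≤ 2 := Real.sqrt_le_iff.2 ⟨by norm_num, by norm_num⟩
    linarith [Real.add_one_le_exp (1 : ℝ)]
  calc _ ≤ Real.exp q * Real.exp (-(q + L)) := by gcongr
    _ = δ₁ := by
      rw [← Real.exp_add, hL, one_div, Real.log_inv,
        show q + -(q + -Real.log δ₁) = Real.log δ₁ by ring, Real.exp_log hδ₁]

end events

end GroupLasso

theorem theorem2 {n m p : ℕ} (sys : GroupLasso.LinSys n m p)
    {Ω : Type*} [MeasurableSpace Ω] (P : Measure Ω) [IsProbabilityMeasure P]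
    -- horizon `{0, …, N}`, initial state, input signal, active set
    (N : ℕ) (x0 : Fin n → ℝ) (u : ℕ → Fin m → ℝ)
    (S : Finset (Fin m)) (hS : S = GroupLasso.activeSet N u)
    (hS_pos : 0 < S.card) (hS_lt : S.card < m)
    -- measurement noise: independent `N(0, σ²)` coordinates
    (σ : ℝ) (hσ : 0 < σ)
    (v : Fin (N + 1) × Fin p → Ω → ℝ) (hv_indep : iIndepFun v P)
    (hv_law : ∀ i, HasLaw (v i) (gaussianReal 0 (Real.toNNReal (σ ^ 2))) P)
    -- the delay `d = η_S` is finite, and `N ≥ max {η_S, μ_S}`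
    (d : ℕ) (hd : sys.inputDelay S = d)
    (hN : max (sys.inputDelay S) (sys.stateDelay S) ≤ N)
    -- group normalization, least singular value, mutual incoherence
    (K cmin α : ℝ) (hcmin : 0 < cmin) (hα : 0 ≤ α) (hα_lt : α < 1)
    (hA1 : sys.GroupNormalized N K)
    (hA2 : sys.LeastSingularValue N d S cmin)
    (hA3 : sys.MutualIncoherence N S α)
    (δ δ₁ : ℝ) (hδ : 0 < δ) (hδ₁ : 0 < δ₁)
    -- minimum input magnitude: `min_{j ∈ S} ‖u_{j,[0:N-d]}‖_∞ ≥ β_min`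
    (hmin : ∀ j ∈ S, sys.betaMin N d S σ K α δ cmin ≤
      ‖fun k : GroupLasso.EarlyTime N d => u k.val j‖) :
    ∃ E : Set Ω, MeasurableSet E ∧
      1 - 4 * Real.exp (-(GroupLasso.numMeas N p * δ ^ 2 / 2)) - δ₁ ≤ P.real E ∧
      ∀ ω ∈ E, ∀ y, y = sys.measurement (N + 1) x0 u (fun i => v i ω) →
        (∃ xh uh, sys.IsGroupLasso N (GroupLasso.lambdaT N m p S σ K α δ) y xh uh) ∧
        ∀ xh uh, sys.IsGroupLasso N (GroupLasso.lambdaT N m p S σ K α δ) y xh uh →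
          GroupLasso.supportSet uh = S ∧
          GroupLasso.l2norm (GroupLasso.delayedTruth N d x0 u -
              sys.delayedOLS N d (GroupLasso.supportSet uh) y) ≤
            4 * σ / √cmin * √(((n : ℝ) + GroupLasso.numDelayed N d S) / GroupLasso.numMeas N p) +
            2 * σ / √cmin * √(1 / GroupLasso.numMeas N p * Real.log (1 / δ₁)) := by
  rcases le_or_gt 1 δ₁ with h1 | hδ₁_lt
  · refine ⟨∅, MeasurableSet.empty, ?_, fun ω hω => hω.elim⟩
    rw [measureReal_empty]
    linarith [Real.exp_pos (-(GroupLasso.numMeas N p * δ ^ 2 / 2))]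
  have hT : 0 < GroupLasso.numMeas N p := sys.numMeas_pos hS_pos hd
  have hK := hA1.pos sys hS_pos hd hN
  have hsub := GroupLasso.isSubgaussianVector_of_iIndepFun_gaussian hv_indep hv_law
  have hv := fun i => (hv_law i).aemeasurable
  have hP1 := sys.measureReal_inactive_noise_le hT hK hσ hα_lt hδ hS_lt hA1 hv hsub
  have hP2 := sys.measureReal_delayed_noise_le hd hN hT hσ hS_pos hδ hcmin hA2 hsub
  have hP3 := sys.measureReal_ols_error_le hd hN hT hσ hcmin hA2 hδ₁ hδ₁_lt hv hsub
  set B1 := ⋃ j ∈ Sᶜ, {ω | (1 - α) * (GroupLasso.numMeas N p *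
    GroupLasso.lambdaT N m p S σ K α δ) ≤ GroupLasso.l2norm (((sys.impulse (N + 1) j)ᵀ *
      (1 - sys.Psi (N + 1) S * GroupLasso.pinv (sys.Psi (N + 1) S))) *ᵥ fun i => v i ω)} with hB1
  set B2 := ⋃ c ∈ (Finset.univ : Finset (GroupLasso.EarlyTime N d × S)),
    {ω | σ / √cmin * (√(2 * Real.log (GroupLasso.numDelayed N d S) / GroupLasso.numMeas N p) + δ) ≤
      |(sys.earlyEstimator N d S *ᵥ fun i => v i ω) (Sum.inr c)|} with hB2
  set B3 := {ω | 4 * σ / √cmin *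
      √(((n : ℝ) + GroupLasso.numDelayed N d S) / GroupLasso.numMeas N p) +
      2 * σ / √cmin * √(1 / GroupLasso.numMeas N p * Real.log (1 / δ₁)) ≤
    GroupLasso.l2norm (sys.earlyEstimator N d S *ᵥ fun i => v i ω)} with hB3
  -- the noise is only a.e.-measurable, so the bad event is replaced by a measurable superset
  refine ⟨(toMeasurable P (B1 ∪ B2 ∪ B3))ᶜ, (measurableSet_toMeasurable _ _).compl, ?_, ?_⟩
  · rw [measureReal_compl (measurableSet_toMeasurable _ _), probReal_univ, measureReal_def,
      measure_toMeasurable, ← measureReal_def]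
    linarith [measureReal_union_le (μ := P) (B1 ∪ B2) B3, measureReal_union_le (μ := P) B1 B2]
  intro ω hω y hy
  have hgood : ω ∉ B1 ∪ B2 ∪ B3 := fun h => hω (subset_toMeasurable P _ h)
  simp only [Set.mem_union, not_or, hB1, hB2, hB3, Set.mem_iUnion, Set.mem_ofPred_eq, not_exists,
    not_le, Finset.mem_compl, Finset.mem_univ, true_implies] at hgood
  obtain ⟨⟨hg1, hg2⟩, hg3⟩ := hgood
  have hrec := sys.support_recovery (y := y) (w := fun i => v i ω)
    (β := GroupLasso.batchTruth N S x0 u) hd hN hT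
    (GroupLasso.lambdaT_pos (m := m) (S := S) hK hσ hα_lt hδ) hS_pos hα hA3
    (by rw [hy, sys.measurement_eq, ← hS])
    (fun j hj => by rw [mulVec_mulVec]; exact hg1 j hj) (fun j => by
      by_contra hcon
      push Not at hcon
      have hsmall : ∀ k : GroupLasso.EarlyTime N d, ‖u k.val j‖ <
          sys.betaMin N d S σ K α δ cmin := by
        intro k
        refine (hcon k).trans_lt ?_
        have h1 := hg2 (k, j)
        have h2 := congrFun (sys.pinv_mulVec_comp_earlyIndex hd hN fun i => v i ω) (Sum.inr (k, j))
        rw [← h2] at h1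
        exact add_lt_add_left h1 _
      have k0 : GroupLasso.EarlyTime N d := ⟨0, by simpa using sys.delay_le hd hN⟩
      have hpos := (norm_nonneg _).trans_lt (hsmall k0)
      exact absurd ((pi_norm_lt_iff hpos).2 hsmall) (not_lt.2 (hmin j j.2)))
  refine ⟨hrec.1, fun xh uh h => ?_⟩
  have hsupp := hrec.2 xh uh h
  refine ⟨hsupp, ?_⟩
  rw [hsupp, hy, sys.l2norm_delayedTruth_sub_delayedOLS hS hd hN]
  exact hg3.le
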